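/- A representation of a set $X$ is a surjective partial function $\delta_X:\subseteq\mathbb N^{\mathbb N}\to X$; the $p$ with $\delta_X(p)=x$ are the names of $x$. A partial function $F:\subseteq\mathbb N^{\mathbb N}\to\mathbb N^{\mathbb N}$ is computable if one program with oracle $p$ computes from every $i$ the entry $F(p)(i)$. A partial function $F:\subseteq\mathbb N^{\mathbb N}\to\mathbb N^{\mathbb N}$ realizes a partial multi-valued function $f:\subseteq X\rightrightarrows Y$ between represented spaces, written $F\vdash f$, if $\delta_Y(F(p))\in f(\delta_X(p))$ for every $p$ with $\delta_X(p)\in\operatorname{dom}(f)$. One writes $f\le_{\mathrm{sW}}g$ if there are computable $H,K:\subseteq\mathbb N^{\mathbb N}\to\mathbb N^{\mathbb N}$ such that $K\circ G\circ H\vdash f$ whenever $G\vdash g$, and $f\equiv_{\mathrm{sW}}g$ if $f\le_{\mathrm{sW}}g$ and $g\le_{\mathrm{sW}}f$. Pairs $(x,y)$ are named by $\langle p,q\rangle=p(0)q(0)p(1)q(1)\dots$ with $p$ a name of $x$ and $q$ a name of $y$. Let $\mathbb R^n$ carry the Euclidean metric $d$, let $\alpha:\mathbb N\to\mathbb Q^n$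 be an effective enumeration of $\mathbb Q^n$, and let $(B_k)_{k\in\mathbb N}$ be the induced effective enumeration of the open balls with center in $\mathbb Q^n$ and rational radius $\ge 0$. A name of a point $x\in\mathbb R^n$ is a $p\in\mathbb N^{\mathbb N}$ with $d(\alpha(p(i)),\alpha(p(j)))\le 2^{-i}$ for all $i\le j$ and $\lim_i\alpha(p(i))=x$. A name (with total information) of a nonempty closed set $A\subseteq\mathbb R^n$ is a $\langle p,q\rangle$ such that $A=\mathbb R^n\setminus\bigcup_{k\in\operatorname{range}(p)}B_k$ and, for every $k$, $k\in\operatorname{range}(q)$ if and only if $B_k\cap A\neq\emptyset$. The exact total projection operator $\operatorname{Proj}_{\mathbb R^n}$ maps a point $x\in\mathbb R^n$ and a nonempty closed set $A\subseteq\mathbb R^n$ to the set of all $y\in A$ with $d(x,y)=d(x,A)=\inf\{d(x,z):z\in A\}$. The operator $\operatorname{WKL}$ maps each infinite binary tree $T\subseteq 2^{<\mathbb N}$ to the set $[T]\subseteq 2^{\mathbb N}$ of its infinite paths; here $T$ is named by its characteristic function along a recursive enumeration of all finite binary words, and an element of $2^{\mathbb N}$ is its own name. Then, for every $n\ge 2$,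 $$\operatorname{Proj}_{\mathbb R^n}\equiv_{\mathrm{sW}}\operatorname{WKL}.$$ -/

import Mathlib

open Filter Topology

noncomputable section

namespace Wei

/-- Baire space, the set of names. -/
abbrev Baire : Type := ℕ → ℕ

/-- Partial recursive functionals with an oracle `p`: the programs `Φ` such that `Φ p n` is the
result, if any, of running a fixed oracle program on the number `n` with the oracle `p`. The
clauses are those of `Nat.Partrec`, uniformly in the oracle, with one more basic program, which
queries the oracle. -/
inductive OracleProgram : (Baire → ℕ →. ℕ) → Prop
  | oracle : OracleProgram fun p n => Part.some (p n)
  | zero : OracleProgram fun _ _ => Part.some 0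
  | succ : OracleProgram fun _ n => Part.some (n + 1)
  | left : OracleProgram fun _ n => Part.some n.unpair.1
  | right : OracleProgram fun _ n => Part.some n.unpair.2
  | pair {Φ Ψ : Baire → ℕ →. ℕ} : OracleProgram Φ → OracleProgram Ψ →
      OracleProgram fun p n => Nat.pair <$> Φ p n <*> Ψ p n
  | comp {Φ Ψ : Baire → ℕ →. ℕ} : OracleProgram Φ → OracleProgram Ψ →
      OracleProgram fun p n => Ψ p n >>= Φ p
  | prec {Φ Ψ : Baire → ℕ →. ℕ} : OracleProgram Φ → OracleProgram Ψ →
      OracleProgram fun p => Nat.unpaired fun a n =>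
        n.rec (Φ p a) fun y IH => do
          let i ← IH
          Ψ p (Nat.pair a (Nat.pair y i))
  | rfind {Φ : Baire → ℕ →. ℕ} : OracleProgram Φ →
      OracleProgram fun p a => Nat.rfind fun n => (fun m => m = 0) <$> Φ p (Nat.pair a n)

/-- A partial function on Baire space is computable if one oracle program, given the input `p` as
an oracle, computes every entry of the output; the input is in the domain exactly if all the
entries of the output get computed. -/
def ComputableOnBaire (F : Baire →. Baire) : Prop :=
  ∃ Φ : Baire → ℕ →. ℕ, OracleProgram Φ ∧ ∀ p q : Baire, q ∈ F p ↔ ∀ n, q n ∈ Φ p n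

/-- A representation of `X`: a surjective partial function from Baire space to `X`, given by its
graph (`IsName p x` says that the value at `p` is `x`). -/
structure Representation (X : Type) where
  IsName : Baire → X → Prop
  unique : ∀ {p : Baire} {x y : X}, IsName p x → IsName p y → x = y
  surj : ∀ x : X, ∃ p : Baire, IsName p x

/-- A partial multi-valued function. -/
structure MultiFun (X Y : Type) where
  dom : Set X
  val : X → Set Y

/-- `F` is a realizer of `f`. -/
def Realizes {X Y : Type} (δX : Representation X) (δY : Representation Y)
    (F : Baire →. Baire) (f : MultiFun X Y) : Prop :=
  ∀ (p : Baire) (x : X), δX.IsName p x → x ∈ f.dom →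
    ∃ q ∈ F p, ∃ y ∈ f.val x, δY.IsName q y

/-- A problem: a partial multi-valued function between represented spaces. -/
structure Problem where
  In : Type
  Out : Type
  repIn : Representation In
  repOut : Representation Out
  fn : MultiFun In Out

/-- Realizers of a problem. -/
def Problem.RealizedBy (f : Problem) (F : Baire →. Baire) : Prop :=
  Realizes f.repIn f.repOut F f.fn

/-- Strong Weihrauch reducibility. -/
def StrongWeihrauchLE (f g : Problem) : Prop :=
  ∃ H K : Baire →. Baire, ComputableOnBaire H ∧ ComputableOnBaire K ∧
    ∀ G : Baire →. Baire, g.RealizedBy G → f.RealizedBy (K.comp (G.comp H))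

/-- Strong Weihrauch equivalence. -/
def StrongWeihrauchEquiv (f g : Problem) : Prop :=
  StrongWeihrauchLE f g ∧ StrongWeihrauchLE g f

/-! ### Pairs -/

/-- The sequence `⟨p, q⟩ = p 0, q 0, p 1, q 1, …`. -/
def join (p q : Baire) : Baire := fun n => if n % 2 = 0 then p (n / 2) else q (n / 2)

theorem join_even (p q : Baire) (n : ℕ) : join p q (2 * n) = p n := by
  simp [join]

theorem join_odd (p q : Baire) (n : ℕ) : join p q (2 * n + 1) = q n := by
  have h : (2 * n + 1) % 2 = 1 := by omega
  have h' : (2 * n + 1) / 2 = n := by omega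
  simp [join, h, h']

theorem join_inj {p q p' q' : Baire} (h : join p q = join p' q') : p = p' ∧ q = q' := by
  constructor
  · funext n
    rw [← join_even p q, h, join_even]
  · funext n
    rw [← join_odd p q, h, join_odd]

/-- The product representation. -/
def Representation.prod {X Y : Type} (δX : Representation X) (δY : Representation Y) :
    Representation (X × Y) where
  IsName r z := ∃ p q, r = join p q ∧ δX.IsName p z.1 ∧ δY.IsName q z.2
  unique := by
    rintro r z w ⟨p, q, rfl, hp, hq⟩ ⟨p', q', h, hp', hq'⟩
    obtain ⟨rfl, rfl⟩ := join_inj h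
    exact Prod.ext (δX.unique hp hp') (δY.unique hq hq')
  surj z := by
    obtain ⟨p, hp⟩ := δX.surj z.1
    obtain ⟨q, hq⟩ := δY.surj z.2
    exact ⟨join p q, p, q, rfl, hp, hq⟩

/-! ### Weak Kőnig's Lemma -/

/-- Binary trees: sets of finite binary words that are closed under initial segments. -/
def BinTree : Type :=
  {T : Set (List Bool) // ∀ w ∈ T, ∀ v : List Bool, v <+: w → v ∈ T}

/-- A recursive enumeration of all finite binary words. -/
def word (n : ℕ) : List Bool := (Encodable.decode (α := List Bool) n).getD []

theorem word_encode (w : List Bool) : word (Encodable.encode w) = w := by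
  simp [word]

/-- Trees are represented by their characteristic functions. -/
def treeRep : Representation BinTree where
  IsName t T := ∀ n, (t n = 0 ∨ t n = 1) ∧ (t n = 1 ↔ word n ∈ T.1)
  unique := by
    intro t S T hS hT
    apply Subtype.ext
    ext w
    rw [← word_encode w, ← (hS _).2, (hT _).2]
  surj T := by
    classical
    refine ⟨fun n => if word n ∈ T.1 then 1 else 0, fun n => ?_⟩
    by_cases h : word n ∈ T.1 <;> simp [h]

/-- The representation of Cantor space: each sequence of bits is its own name. -/
def cantorRep : Representation (ℕ → Bool) where
  IsName p x := ∀ n, p n = (x n).toNat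
  unique := by
    intro p x y hx hy
    funext n
    have h : (x n).toNat = (y n).toNat := by rw [← hx, hy]
    revert h
    cases x n <;> cases y n <;> simp
  surj x := ⟨fun n => (x n).toNat, fun _ => rfl⟩

/-- The infinite paths of a binary tree. -/
def paths (T : BinTree) : Set (ℕ → Bool) :=
  {x | ∀ n, (List.range n).map x ∈ T.1}

/-- Weak Kőnig's Lemma: given an infinite binary tree, find an infinite path. -/
def WKL : Problem where
  In := BinTree
  Out := ℕ → Bool
  repIn := treeRep
  repOut := cantorRep
  fn :=
    { dom := {T | T.1.Infinite}
      val := paths }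

/-! ### Euclidean space as a computable metric space -/

/-- The `n`-dimensional Euclidean space, with the Euclidean metric. -/
abbrev Euc (n : ℕ) : Type := EuclideanSpace ℝ (Fin n)

/-- An effective enumeration of the rational numbers: the code `⟨⟨a, b⟩, c⟩` stands for
`(a - b) / (c + 1)`. -/
def ratNum (k : ℕ) : ℚ :=
  ((k.unpair.1.unpair.1 : ℚ) - k.unpair.1.unpair.2) / (k.unpair.2 + 1)

/-- An effective enumeration of the nonnegative rational numbers: the code `⟨a, b⟩` stands for
`a / (b + 1)`. -/
def nonnegRatNum (k : ℕ) : ℚ := (k.unpair.1 : ℚ) / (k.unpair.2 + 1)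

/-- The entry with index `i` of the sequence coded by `⟨k₀, ⟨k₁, ⟨k₂, …⟩⟩⟩`. -/
def entry : ℕ → ℕ → ℕ
  | 0, k => k.unpair.1
  | i + 1, k => entry i k.unpair.2

/-- An effective enumeration of the points with rational coordinates. -/
def ratPoint (n : ℕ) (k : ℕ) : Euc n :=
  WithLp.toLp 2 fun i => ((ratNum (entry i k) : ℚ) : ℝ)

/-- The basic open ball with the code `⟨a, b⟩`. -/
def basicBall (n : ℕ) (k : ℕ) : Set (Euc n) :=
  Metric.ball (ratPoint n k.unpair.1) ((nonnegRatNum k.unpair.2 : ℚ) : ℝ)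

theorem ratNum_surj (q : ℚ) : ∃ k, ratNum k = q := by
  refine ⟨Nat.pair (Nat.pair q.num.toNat (-q.num).toNat) (q.den - 1), ?_⟩
  have h1 : ((q.num.toNat : ℚ) - ((-q.num).toNat : ℚ)) = (q.num : ℚ) := by
    exact_mod_cast congrArg (Int.cast (R := ℚ)) (show ((q.num.toNat : ℤ) - ((-q.num).toNat : ℤ)) =
      q.num by omega)
  have h2 : (((q.den - 1 : ℕ) : ℚ) + 1) = q.den := by
    have := q.den_pos
    exact_mod_cast (show q.den - 1 + 1 = q.den by omega)
  simp only [ratNum, Nat.unpair_pair, h1, h2]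
  exact q.num_div_den

theorem nonnegRatNum_surj {q : ℚ} (hq : 0 ≤ q) : ∃ k, nonnegRatNum k = q := by
  refine ⟨Nat.pair q.num.toNat (q.den - 1), ?_⟩
  have h1 : (q.num.toNat : ℚ) = (q.num : ℚ) := by
    have := Rat.num_nonneg.2 hq
    exact_mod_cast congrArg (Int.cast (R := ℚ)) (show (q.num.toNat : ℤ) = q.num by omega)
  have h2 : (((q.den - 1 : ℕ) : ℚ) + 1) = q.den := by
    have := q.den_pos
    exact_mod_cast (show q.den - 1 + 1 = q.den by omega)
  simp only [nonnegRatNum, Nat.unpair_pair, h1, h2]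
  exact q.num_div_den

theorem entry_surj (n : ℕ) : ∀ v : ℕ → ℕ, ∃ k, ∀ i < n, entry i k = v i := by
  induction n with
  | zero => exact fun v => ⟨0, fun i hi => absurd hi (Nat.not_lt_zero i)⟩
  | succ n ih =>
    intro v
    obtain ⟨k, hk⟩ := ih fun i => v (i + 1)
    refine ⟨Nat.pair (v 0) k, fun i hi => ?_⟩
    cases i with
    | zero => simp [entry]
    | succ i => simpa [entry] using hk i (by omega)

theorem ratPoint_surj {n : ℕ} (v : Fin n → ℚ) :
    ∃ k, ratPoint n k = WithLp.toLp 2 fun i => (v i : ℝ) := by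
  choose c hc using fun i => ratNum_surj (v i)
  obtain ⟨k, hk⟩ := entry_surj n fun i => if h : i < n then c ⟨i, h⟩ else 0
  refine ⟨k, ?_⟩
  unfold ratPoint
  congr 1
  funext i
  rw [hk i i.2]
  simp [hc]

theorem ratPoint_dense (n : ℕ) : DenseRange (ratPoint n) := by
  have h1 : DenseRange fun v : Fin n → ℚ => fun i => (v i : ℝ) :=
    DenseRange.piMap fun _ => Rat.denseRange_cast
  have h2 : DenseRange fun v : Fin n → ℚ => (WithLp.toLp 2 fun i => (v i : ℝ) : Euc n) :=
    (WithLp.toLp_surjective 2).denseRange.comp h1 (PiLp.continuous_toLp 2 _)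
  refine h2.mono ?_
  rintro _ ⟨v, rfl⟩
  exact ratPoint_surj v

/-- Between a point and an open set that contains it there is a basic ball. -/
theorem exists_basicBall {n : ℕ} {U : Set (Euc n)} (hU : IsOpen U) {x : Euc n} (hx : x ∈ U) :
    ∃ k, x ∈ basicBall n k ∧ basicBall n k ⊆ U := by
  obtain ⟨ε, hε, hb⟩ := Metric.isOpen_iff.1 hU x hx
  obtain ⟨q, hq0, hq⟩ := exists_rat_btwn (half_pos hε)
  obtain ⟨a, ha⟩ := (ratPoint_dense n).exists_dist_lt x hq0
  obtain ⟨b, hb'⟩ := nonnegRatNum_surj (q := q) (by exact_mod_cast hq0.le)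
  refine ⟨Nat.pair a b, ?_, ?_⟩
  · simpa [basicBall, hb'] using ha
  · intro y hy
    apply hb
    simp only [basicBall, Nat.unpair_pair, hb', Metric.mem_ball] at hy ⊢
    have := dist_triangle y (ratPoint n a) x
    rw [dist_comm] at ha
    linarith

/-- The Cauchy representation of Euclidean space. -/
def cauchyRep (n : ℕ) : Representation (Euc n) where
  IsName p x :=
    (∀ i j, i ≤ j → dist (ratPoint n (p i)) (ratPoint n (p j)) ≤ (2 : ℝ)⁻¹ ^ i) ∧
      Tendsto (fun i => ratPoint n (p i)) atTop (𝓝 x)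
  unique hx hy := tendsto_nhds_unique hx.2 hy.2
  surj x := by
    have hpos : ∀ i : ℕ, (0 : ℝ) < (2 : ℝ)⁻¹ ^ i / 2 := fun i => by positivity
    choose p hp using fun i : ℕ => (ratPoint_dense n).exists_dist_lt x (hpos i)
    have hlim : Tendsto (fun i : ℕ => (2 : ℝ)⁻¹ ^ i / 2) atTop (𝓝 0) := by
      have := (tendsto_pow_atTop_nhds_zero_of_lt_one (r := (2 : ℝ)⁻¹) (by norm_num)
        (by norm_num)).div_const 2
      simpa using this
    refine ⟨p, fun i j hij => ?_, ?_⟩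
    · have h1 := dist_triangle_left (ratPoint n (p i)) (ratPoint n (p j)) x
      have h2 : (2 : ℝ)⁻¹ ^ j ≤ (2 : ℝ)⁻¹ ^ i :=
        pow_le_pow_of_le_one (by norm_num) (by norm_num) hij
      linarith [hp i, hp j]
    · rw [tendsto_iff_dist_tendsto_zero]
      refine squeeze_zero (fun _ => dist_nonneg) (fun i => ?_) hlim
      rw [dist_comm]
      exact (hp i).le

/-! ### Closed sets with total information -/

/-- `p` is a negative name of `A`: it lists basic balls whose union is the complement of `A`. -/
def NegName (n : ℕ) (p : Baire) (A : Set (Euc n)) : Prop :=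
  A = (⋃ k ∈ Set.range p, basicBall n k)ᶜ

/-- `p` is a positive name of `A`: it lists exactly the basic balls that meet `A`. -/
def PosName (n : ℕ) (p : Baire) (A : Set (Euc n)) : Prop :=
  ∀ k, k ∈ Set.range p ↔ (basicBall n k ∩ A).Nonempty

/-- The nonempty closed subsets of Euclidean space. -/
def NonemptyClosed (n : ℕ) : Type := {A : Set (Euc n) // IsClosed A ∧ A.Nonempty}

/-- A nonempty set of numbers is the range of a sequence. -/
theorem exists_range_eq {S : Set ℕ} (hS : S.Nonempty) : ∃ p : Baire, Set.range p = S := by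
  obtain ⟨p, hp⟩ := S.to_countable.exists_eq_range hS
  exact ⟨p, hp.symm⟩

/-- The total information representation of the nonempty closed sets: a name joins a negative and
a positive name. (The empty set has no positive name, since the range of a sequence is not
empty.) -/
def closedRep (n : ℕ) : Representation (NonemptyClosed n) where
  IsName r A := ∃ p q, r = join p q ∧ NegName n p A.1 ∧ PosName n q A.1
  unique := by
    rintro r A B ⟨p, q, rfl, hp, -⟩ ⟨p', q', h, hp', -⟩
    obtain ⟨rfl, rfl⟩ := join_inj h
    apply Subtype.ext
    rw [hp, hp']
  surj A := by
    have hneg : ∃ p : Baire, Set.range p = {k | basicBall n k ⊆ A.1ᶜ} :=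
      exists_range_eq ⟨0, by simp [basicBall, nonnegRatNum]⟩
    have hpos : ∃ q : Baire, Set.range q = {k | (basicBall n k ∩ A.1).Nonempty} := by
      obtain ⟨x, hx⟩ := A.2.2
      obtain ⟨k, hk, -⟩ := exists_basicBall isOpen_univ (Set.mem_univ x)
      exact exists_range_eq ⟨k, x, hk, hx⟩
    obtain ⟨p, hp⟩ := hneg
    obtain ⟨q, hq⟩ := hpos
    refine ⟨join p q, p, q, rfl, ?_, fun k => by rw [hq]; rfl⟩
    unfold NegName
    rw [hp, eq_compl_comm]
    ext x
    simp only [Set.mem_iUnion, Set.mem_ofPred_eq, exists_prop]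
    constructor
    · rintro ⟨k, hk, hx⟩
      exact hk hx
    · intro hx
      obtain ⟨k, hk, hkA⟩ := exists_basicBall A.2.1.isOpen_compl hx
      exact ⟨k, hkA, hk⟩

/-! ### Projections -/

/-- The projection points of `x` onto `A`. -/
def projPoints {X : Type} [MetricSpace X] (x : X) (A : Set X) : Set X :=
  {y | y ∈ A ∧ dist x y = Metric.infDist x A}

/-- The exact total projection operator on Euclidean space: given a point and a nonempty closed
set with total information, find a projection point of the point onto the set. -/
def Proj (n : ℕ) : Problem where
  In := Euc n × NonemptyClosed n
  Out := Euc n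
  repIn := (cauchyRep n).prod (closedRep n)
  repOut := cauchyRep n
  fn :=
    { dom := Set.univ
      val := fun z => projPoints z.1 z.2.1 }

end Wei

end

/-!
For the upper bound, positive information on `A` bounds the distance from `x` to `A` from above at
any precision. Hence the names of projection points are the sequences in a computably bounded
product that avoid a list of decidable obstacles: they must stay out of the negative balls and must
not be farther from `x` than any upper bound that shows up. Coding the graph of such a sequence by
the bits of a binary path turns these obstacles into a computable binary tree.

For the lower bound, infinite binary words are coded by points of the unit circle, with octal
digits `0` and `1` so that different words stay apart, and a finite word `w` by the corresponding
point on the slightly larger circle of radius `1 + 8 ^ (-|w|) / 16`. The closure of the points of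
the words in a tree has total information computable from the tree, because a word of length `m`
locates all its extensions up to `8 ^ (-m)`. The radii decrease strictly along the levels of an
infinite tree, so a nearest point to the origin codes an infinite path.
-/

open Filter Topology

noncomputable section

namespace Wei

/-! ### Computability relative to an oracle -/

theorem OracleProgram.of_eq {Φ Ψ : Baire → ℕ →. ℕ} (hΦ : OracleProgram Φ)
    (h : ∀ p n, Φ p n = Ψ p n) : OracleProgram Ψ :=
  (funext₂ h : Φ = Ψ) ▸ hΦ

theorem OracleProgram.some_comp {F G : Baire → ℕ → ℕ}
    (hF : OracleProgram fun p n => Part.some (F p n))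
    (hG : OracleProgram fun p n => Part.some (G p n)) :
    OracleProgram fun p n => Part.some (F p (G p n)) :=
  (hF.comp hG).of_eq fun _ _ => Part.bind_some _ _

theorem OracleProgram.some_pair {F G : Baire → ℕ → ℕ}
    (hF : OracleProgram fun p n => Part.some (F p n))
    (hG : OracleProgram fun p n => Part.some (G p n)) :
    OracleProgram fun p n => Part.some (Nat.pair (F p n) (G p n)) :=
  (hF.pair hG).of_eq fun p n => by simp [Seq.seq]

theorem OracleProgram.some_prec {F G : Baire → ℕ → ℕ}
    (hF : OracleProgram fun p n => Part.some (F p n))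
    (hG : OracleProgram fun p n => Part.some (G p n)) :
    OracleProgram fun p => (Nat.unpaired fun a n => Part.some
      (n.rec (F p a) fun y IH => G p (Nat.pair a (Nat.pair y IH)) : ℕ) : ℕ →. ℕ) := by
  refine (hF.prec hG).of_eq fun p n => ?_
  simp only [Nat.unpaired]
  induction n.unpair.2 with
  | zero => rfl
  | succ m ih =>
    simp only [ih]
    exact Part.bind_some _ _

theorem OracleProgram.of_natPrimrec {f : ℕ → ℕ} (hf : Nat.Primrec f) :
    OracleProgram fun _ n => Part.some (f n) := by
  induction hf with
  | zero => exact .zero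
  | succ => exact .succ
  | left => exact .left
  | right => exact .right
  | pair _ _ hf hg => exact hf.some_pair hg
  | comp _ _ hf hg => exact hf.some_comp hg
  | prec _ _ hf hg => exact hf.some_prec hg

/-- Total functions between coded types computed by one program with an oracle. Unlike
`OracleProgram`, which it is built on, this notion is closed under the usual ways of defining
total functions without any mention of codes. -/
def OracleComputable {α β : Type} [Primcodable α] [Primcodable β] (f : Baire → α → β) : Prop :=
  ∃ F : Baire → ℕ → ℕ, OracleProgram (fun p n => Part.some (F p n)) ∧
    ∀ p a, F p (Encodable.encode a) = Encodable.encode (f p a)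

namespace OracleComputable

variable {α β γ δ : Type} [Primcodable α] [Primcodable β] [Primcodable γ] [Primcodable δ]

theorem of_eq {f g : Baire → α → β} (hf : OracleComputable f) (h : ∀ p a, f p a = g p a) :
    OracleComputable g :=
  (funext₂ h : f = g) ▸ hf

theorem of_primrec {f : α → β} (hf : Primrec f) : OracleComputable fun _ => f :=
  ⟨_, .of_natPrimrec (.comp .pred hf), fun _ a => by simp⟩

protected theorem id : OracleComputable fun _ (a : α) => a := of_primrec .id

theorem const (b : β) : OracleComputable fun _ (_ : α) => b := of_primrec (.const b)

theorem comp {f : Baire → β → γ} {g : Baire → α → β} (hf : OracleComputable f)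
    (hg : OracleComputable g) : OracleComputable fun p a => f p (g p a) := by
  obtain ⟨F, hF, hFf⟩ := hf
  obtain ⟨G, hG, hGg⟩ := hg
  exact ⟨_, hF.some_comp hG, fun p a => by rw [hGg, hFf]⟩

theorem apply {f : Baire → α → ℕ} (hf : OracleComputable f) :
    OracleComputable fun p a => p (f p a) :=
  comp (f := fun p => p) ⟨_, .oracle, fun _ _ => rfl⟩ hf

theorem pair {f : Baire → α → β} {g : Baire → α → γ} (hf : OracleComputable f)
    (hg : OracleComputable g) : OracleComputable fun p a => (f p a, g p a) := by
  obtain ⟨F, hF, hFf⟩ := hf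
  obtain ⟨G, hG, hGg⟩ := hg
  exact ⟨_, hF.some_pair hG, fun p a => by simp [hFf, hGg]⟩

theorem primrec_comp {f : β → γ} {g : Baire → α → β} (hf : Primrec f)
    (hg : OracleComputable g) : OracleComputable fun p a => f (g p a) :=
  (of_primrec hf).comp hg

theorem primrec₂_comp {f : β → γ → δ} {g : Baire → α → β} {h : Baire → α → γ}
    (hf : Primrec₂ f) (hg : OracleComputable g) (hh : OracleComputable h) :
    OracleComputable fun p a => f (g p a) (h p a) :=
  primrec_comp hf (hg.pair hh)

theorem fst {f : Baire → α → β × γ} (hf : OracleComputable f) :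
    OracleComputable fun p a => (f p a).1 :=
  primrec_comp .fst hf

theorem snd {f : Baire → α → β × γ} (hf : OracleComputable f) :
    OracleComputable fun p a => (f p a).2 :=
  primrec_comp .snd hf

theorem unpair {f : Baire → α → ℕ} (hf : OracleComputable f) :
    OracleComputable fun p a => (f p a).unpair :=
  primrec_comp .unpair hf

theorem nat_rec {f : Baire → α → β} {g : Baire → α × ℕ × β → β} {n : Baire → α → ℕ}
    (hf : OracleComputable f) (hg : OracleComputable g) (hn : OracleComputable n) :
    OracleComputable fun p a =>
      ((n p a).rec (f p a) fun k b => g p (a, k, b) : β) := by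
  obtain ⟨F, hF, hFf⟩ := hf
  obtain ⟨G, hG, hGg⟩ := hg
  obtain ⟨N, hN, hNn⟩ := hn
  refine ⟨_, (hF.some_prec hG).some_comp ((OracleProgram.of_natPrimrec .id).some_pair hN),
    fun p a => ?_⟩
  simp only [id, Nat.unpair_pair, hNn, Encodable.encode_nat]
  induction n p a with
  | zero => exact hFf p a
  | succ k ih =>
    simp only [ih]
    exact hGg p (a, k, _)

end OracleComputable

open Classical in
/-- Relations that one program with an oracle decides. -/
def OracleDecidable {α : Type} [Primcodable α] (P : Baire → α → Prop) : Prop :=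
  OracleComputable fun p a => decide (P p a)

namespace OracleDecidable

variable {α β γ : Type} [Primcodable α] [Primcodable β] [Primcodable γ]
  {P Q : Baire → α → Prop}

theorem of_iff (hP : OracleDecidable P) (h : ∀ p a, P p a ↔ Q p a) : OracleDecidable Q :=
  (funext₂ fun p a => propext (h p a) : P = Q) ▸ hP

theorem of_primrecPred {P : α → Prop} (hP : PrimrecPred P) : OracleDecidable fun _ => P := by
  obtain ⟨_, h⟩ := hP
  exact (OracleComputable.of_primrec h).of_eq fun _ _ => by congr

theorem comp {P : Baire → β → Prop} {f : Baire → α → β} (hP : OracleDecidable P)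
    (hf : OracleComputable f) : OracleDecidable fun p a => P p (f p a) :=
  OracleComputable.comp hP hf

theorem primrecRel_comp {R : β → γ → Prop} {f : Baire → α → β} {g : Baire → α → γ}
    (hR : PrimrecRel R) (hf : OracleComputable f) (hg : OracleComputable g) :
    OracleDecidable fun p a => R (f p a) (g p a) :=
  (of_primrecPred hR).comp (hf.pair hg)

theorem eq {f g : Baire → α → β} (hf : OracleComputable f) (hg : OracleComputable g) :
    OracleDecidable fun p a => f p a = g p a :=
  primrecRel_comp Primrec.eq hf hg

theorem nat_lt {f g : Baire → α → ℕ} (hf : OracleComputable f) (hg : OracleComputable g) :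
    OracleDecidable fun p a => f p a < g p a :=
  primrecRel_comp Primrec.nat_lt hf hg

theorem nat_le {f g : Baire → α → ℕ} (hf : OracleComputable f) (hg : OracleComputable g) :
    OracleDecidable fun p a => f p a ≤ g p a :=
  primrecRel_comp Primrec.nat_le hf hg

theorem not (hP : OracleDecidable P) : OracleDecidable fun p a => ¬P p a :=
  (OracleComputable.primrec_comp Primrec.not hP).of_eq fun _ _ => by simp

theorem and (hP : OracleDecidable P) (hQ : OracleDecidable Q) :
    OracleDecidable fun p a => P p a ∧ Q p a :=
  (OracleComputable.primrec₂_comp Primrec.and hP hQ).of_eq fun _ _ => by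
    rw [Bool.eq_iff_iff]
    simp

theorem imp (hP : OracleDecidable P) (hQ : OracleDecidable Q) :
    OracleDecidable fun p a => P p a → Q p a :=
  (hP.and hQ.not).not.of_iff fun _ _ => by tauto

theorem forall_lt {P : Baire → α × ℕ → Prop} {n : Baire → α → ℕ} (hP : OracleDecidable P)
    (hn : OracleComputable n) : OracleDecidable fun p a => ∀ i < n p a, P p (a, i) := by
  classical
  have hstep : OracleComputable fun p (z : α × ℕ × Bool) =>
      z.2.2 && decide (P p (z.1, z.2.1)) :=
    .primrec₂_comp Primrec.and (.snd (.snd .id))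
      (hP.comp (.pair (.fst .id) (.fst (.snd .id))))
  refine (OracleComputable.nat_rec (.const true) hstep hn).of_eq fun p a => ?_
  beta_reduce
  induction n p a with
  | zero => simp
  | succ m ih =>
    rw [Bool.eq_iff_iff]
    simp only [ih, Bool.and_eq_true, decide_eq_true_eq, Nat.forall_lt_succ_right]

theorem exists_lt {P : Baire → α × ℕ → Prop} {n : Baire → α → ℕ} (hP : OracleDecidable P)
    (hn : OracleComputable n) : OracleDecidable fun p a => ∃ i < n p a, P p (a, i) :=
  (hP.not.forall_lt hn).not.of_iff fun _ _ => by push Not; rfl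

theorem ite {f g : Baire → α → β} [∀ p a, Decidable (P p a)] (hP : OracleDecidable P)
    (hf : OracleComputable f) (hg : OracleComputable g) :
    OracleComputable fun p a => if P p a then f p a else g p a := by
  have hcond : Primrec fun z : Bool × β × β => bif z.1 then z.2.1 else z.2.2 :=
    .cond .fst (.comp .fst .snd) (.comp .snd .snd)
  exact (OracleComputable.primrec_comp hcond (.pair hP (hf.pair hg))).of_eq fun p a => by
    by_cases h : P p a <;> simp [h]

end OracleDecidable

/-! ### Reductions that translate outputs by a search -/

theorem computableOnBaire_of_oracleComputable {f : Baire → ℕ → ℕ} (hf : OracleComputable f) :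
    ComputableOnBaire fun p => Part.some (f p) := by
  obtain ⟨F, hF, hFf⟩ := hf
  refine ⟨_, hF, fun p q => ?_⟩
  simp only [Part.mem_some_iff, funext_iff]
  exact forall_congr' fun n => by rw [show F p n = f p n from hFf p n]

theorem exists_oracleProgram_search {test : Baire → ℕ × ℕ × ℕ → Prop}
    (htest : OracleDecidable test) :
    ∃ Φ : Baire → ℕ →. ℕ, OracleProgram Φ ∧
      ∀ p n, (∃ v s, test p (n, v, s)) → ∃ v ∈ Φ p n, ∃ s, test p (n, v, s) := by
  classical
  have hdecode : OracleComputable fun _ (m : ℕ) =>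
      (m.unpair.1, m.unpair.2.unpair.1, m.unpair.2.unpair.2) :=
    .pair (.fst (.unpair .id)) (.unpair (.snd (.unpair .id)))
  obtain ⟨F, hF, hFtest⟩ :=
    (htest.comp hdecode).ite (OracleComputable.const 0) (OracleComputable.const 1)
  have hzero : ∀ p n s, F p (Nat.pair n s) = 0 ↔ test p (n, s.unpair.1, s.unpair.2) := by
    intro p n s
    have h := hFtest p (Nat.pair n s)
    simp only [Encodable.encode_nat, Nat.unpair_pair] at h
    rw [h]
    split_ifs with ht <;> simp [ht]
  refine ⟨_, OracleProgram.left.comp hF.rfind, fun p n ⟨v, s, hvs⟩ => ?_⟩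
  have hdom : (Nat.rfind fun m => (fun k => decide (k = 0)) <$> Part.some (F p (n.pair m))).Dom :=
    Nat.rfind_dom'.2 ⟨Nat.pair v s, by simpa [hzero] using hvs, fun _ => trivial⟩
  have hleast := Nat.rfind_spec (Part.get_mem hdom)
  refine ⟨_, Part.mem_bind (Part.get_mem hdom) (Part.mem_some _), _, (hzero p n _).1 ?_⟩
  simpa using hleast

theorem exists_computableOnBaire_selector {test : Baire → ℕ × ℕ × ℕ → Prop}
    (htest : OracleDecidable test) :
    ∃ K : Baire →. Baire, ComputableOnBaire K ∧ ∀ p, (∀ n, ∃ v s, test p (n, v, s)) →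
      ∃ r ∈ K p, ∀ n, ∃ s, test p (n, r n, s) := by
  obtain ⟨Φ, hΦ, hsearch⟩ := exists_oracleProgram_search htest
  have hmem : ∀ p q, q ∈ (⟨∀ n, (Φ p n).Dom, fun h n => (Φ p n).get (h n)⟩ : Part Baire) ↔
      ∀ n, q n ∈ Φ p n := fun p q =>
    ⟨fun ⟨h, hq⟩ n => hq ▸ Part.get_mem (h n),
      fun h => ⟨fun n => (h n).fst, funext fun n => (h n).snd⟩⟩
  refine ⟨_, ⟨Φ, hΦ, hmem⟩, fun p hp => ?_⟩
  choose r hr hrtest using fun n => hsearch p n (hp n)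
  exact ⟨r, (hmem p r).2 hr, hrtest⟩

theorem strongWeihrauchLE_of_search {f g : Problem} {pre : Baire → ℕ → ℕ}
    {test : Baire → ℕ × ℕ × ℕ → Prop} (hpre : OracleComputable pre)
    (htest : OracleDecidable test)
    (h : ∀ p x, f.repIn.IsName p x → x ∈ f.fn.dom →
      ∃ x' ∈ g.fn.dom, g.repIn.IsName (pre p) x' ∧
        ∀ q, ∀ y' ∈ g.fn.val x', g.repOut.IsName q y' →
          (∀ n, ∃ v s, test q (n, v, s)) ∧
          ∀ r : Baire, (∀ n, ∃ s, test q (n, r n, s)) →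
            ∃ y ∈ f.fn.val x, f.repOut.IsName r y) :
    StrongWeihrauchLE f g := by
  obtain ⟨K, hK, hselect⟩ := exists_computableOnBaire_selector htest
  refine ⟨_, K, computableOnBaire_of_oracleComputable hpre, hK, fun G hG p x hp hx => ?_⟩
  obtain ⟨x', hx', hname, hout⟩ := h p x hp hx
  obtain ⟨q, hq, y', hy', hqy⟩ := hG _ x' hname hx'
  obtain ⟨htotal, hcorrect⟩ := hout q y' hy' hqy
  obtain ⟨r, hr, hrtest⟩ := hselect q htotal
  obtain ⟨y, hy, hry⟩ := hcorrect r hrtest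
  exact ⟨r, Part.mem_bind (Part.mem_bind (Part.mem_some _) hq) hr, y, hy, hry⟩

/-! ### Computably bounded classes of sequences as sets of paths -/

theorem primrec_word : Primrec word :=
  Primrec.option_getD.comp Primrec.decode (Primrec.const [])

theorem getElem?_map_range_eq_some {α : Type*} {x : ℕ → α} {m a : ℕ} {v : α} :
    ((List.range m).map x)[a]? = some v ↔ a < m ∧ x a = v := by
  simp [List.getElem?_eq_some_iff]

theorem infinite_of_mem_paths {T : BinTree} {x : ℕ → Bool} (hx : x ∈ paths T) : T.1.Infinite :=
  Set.infinite_of_injective_forall_mem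
    (fun m k h => by simpa using congrArg List.length h) hx

open Classical in
theorem treeRep_isName (T : BinTree) :
    treeRep.IsName (fun m => if word m ∈ T.1 then 1 else 0) T := by
  intro m
  by_cases h : word m ∈ T.1 <;> simp [h]

/-- The tree of the attempts to guess a sequence `q` with `q i < b i` whose entries satisfy the
binary constraint `C`, which sees entries together with their indices. The bit with the index
`⟨i, k⟩` is the truth value of `q i = k`. -/
def constraintTree (b : ℕ → ℕ) (C : ℕ × ℕ → ℕ × ℕ → Prop) : BinTree :=
  ⟨{w | (∀ i < w.length, ∃ k < b i, w[Nat.pair i k]? ≠ some false) ∧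
      ∀ a < w.length, ∀ c < w.length,
        w[a]? = some true → w[c]? = some true → C a.unpair c.unpair}, by
    rintro w ⟨hbound, hC⟩ v hvw
    have hlen := hvw.length_le
    have hget : ∀ {a x}, v[a]? = some x → w[a]? = some x := fun h => by
      obtain ⟨ha, rfl⟩ := List.getElem?_eq_some_iff.1 h
      exact List.prefix_iff_getElem?.1 hvw _ ha
    refine ⟨fun i hi => ?_, fun a ha c hc hva hvc =>
      hC a (ha.trans_le hlen) c (hc.trans_le hlen) (hget hva) (hget hvc)⟩
    obtain ⟨k, hk, hne⟩ := hbound i (hi.trans_le hlen)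
    exact ⟨k, hk, fun h => hne (hget h)⟩⟩

theorem mem_paths_constraintTree {b : ℕ → ℕ} {C : ℕ × ℕ → ℕ × ℕ → Prop} {x : ℕ → Bool} :
    x ∈ paths (constraintTree b C) ↔ (∀ i, ∃ k < b i, x (Nat.pair i k) = true) ∧
      ∀ a c, x a = true → x c = true → C a.unpair c.unpair := by
  constructor
  · intro hx
    refine ⟨fun i => ?_, fun a c ha hc => ?_⟩
    · obtain ⟨k, hk, hne⟩ := (hx (Nat.pair i (b i) + 1)).1 i
        (by simpa using Nat.lt_succ_of_le (Nat.left_le_pair i (b i)))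
      have hlt : Nat.pair i k < Nat.pair i (b i) + 1 :=
        (Nat.pair_lt_pair_right i hk).trans (Nat.lt_succ_self _)
      exact ⟨k, hk, by simpa [getElem?_map_range_eq_some, hlt] using hne⟩
    · have hm : a < a + c + 1 ∧ c < a + c + 1 := by omega
      exact (hx (a + c + 1)).2 a (by simp) c (by simp)
        (getElem?_map_range_eq_some.2 ⟨hm.1, ha⟩) (getElem?_map_range_eq_some.2 ⟨hm.2, hc⟩)
  · rintro ⟨hbound, hC⟩ m
    refine ⟨fun i _ => ?_, fun a _ c _ ha hc => hC a c (getElem?_map_range_eq_some.1 ha).2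
      (getElem?_map_range_eq_some.1 hc).2⟩
    obtain ⟨k, hk, hx⟩ := hbound i
    exact ⟨k, hk, fun h => by simp [(getElem?_map_range_eq_some.1 h).2] at hx⟩

theorem oracleDecidable_mem_constraintTree {b : Baire → ℕ → ℕ}
    {C : Baire → ℕ × ℕ → ℕ × ℕ → Prop} (hb : OracleComputable b)
    (hC : OracleDecidable fun r (z : (ℕ × ℕ) × ℕ × ℕ) => C r z.1 z.2) :
    OracleDecidable fun r w => w ∈ (constraintTree (b r) (C r)).1 := by
  have hlen : OracleComputable fun _ (w : List Bool) => w.length := .of_primrec .list_length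
  have hbit {α : Type} [Primcodable α] (v : Bool) {w : Baire → α → List Bool} {c : Baire → α → ℕ}
      (hw : OracleComputable w) (hc : OracleComputable c) :
      OracleDecidable fun r a => (w r a)[c r a]? = some v :=
    .eq (.primrec₂_comp .list_getElem? hw hc) (.const _)
  have hbound : OracleDecidable fun r (w : List Bool) =>
      ∀ i < w.length, ∃ k < b r i, w[Nat.pair i k]? ≠ some false :=
    .forall_lt (P := fun r (z : List Bool × ℕ) => ∃ k < b r z.2, z.1[Nat.pair z.2 k]? ≠ some false)
      (.exists_lt (P := fun _ (z : (List Bool × ℕ) × ℕ) => z.1.1[Nat.pair z.1.2 z.2]? ≠ some false)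
        (hbit false (.fst (.fst .id)) (.primrec₂_comp .natPair (.snd (.fst .id)) (.snd .id))).not
        (hb.comp (.snd .id)))
      hlen
  have hconstraint : OracleDecidable fun r (w : List Bool) =>
      ∀ a < w.length, ∀ c < w.length,
        w[a]? = some true → w[c]? = some true → C r a.unpair c.unpair :=
    .forall_lt (P := fun r (z : List Bool × ℕ) => ∀ c < z.1.length,
        z.1[z.2]? = some true → z.1[c]? = some true → C r z.2.unpair c.unpair)
      (.forall_lt (P := fun r (z : (List Bool × ℕ) × ℕ) =>
          z.1.1[z.1.2]? = some true → z.1.1[z.2]? = some true → C r z.1.2.unpair z.2.unpair)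
        ((hbit true (.fst (.fst .id)) (.snd (.fst .id))).imp
          ((hbit true (.fst (.fst .id)) (.snd .id)).imp
            (hC.comp (.pair (.unpair (.snd (.fst .id))) (.unpair (.snd .id))))))
        (hlen.comp (.fst .id)))
      hlen
  exact hbound.and hconstraint

theorem strongWeihrauchLE_WKL_of_constraints {f : Problem} {b : Baire → ℕ → ℕ}
    {C : Baire → ℕ × ℕ → ℕ × ℕ → Prop} (hb : OracleComputable b)
    (hC : OracleDecidable fun r (z : (ℕ × ℕ) × ℕ × ℕ) => C r z.1 z.2)
    (h : ∀ r x, f.repIn.IsName r x → x ∈ f.fn.dom →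
      (∃ q : Baire, (∀ i, q i < b r i) ∧ ∀ i j, C r (i, q i) (j, q j)) ∧
      ∀ q : Baire, (∀ i j, C r (i, q i) (j, q j)) → ∃ y ∈ f.fn.val x, f.repOut.IsName q y) :
    StrongWeihrauchLE f WKL := by
  classical
  have hpre : OracleComputable fun r (m : ℕ) =>
      if word m ∈ (constraintTree (b r) (C r)).1 then 1 else 0 :=
    ((oracleDecidable_mem_constraintTree hb hC).comp (.of_primrec primrec_word)).ite
      (.const 1) (.const 0)
  have htest : OracleDecidable fun p (z : ℕ × ℕ × ℕ) => p (Nat.pair z.1 z.2.1) = 1 :=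
    .eq (.apply (.primrec₂_comp .natPair (.fst .id) (.fst (.snd .id)))) (.const 1)
  refine strongWeihrauchLE_of_search hpre htest fun r x hr hx => ?_
  obtain ⟨⟨q, hqb, hqC⟩, hsound⟩ := h r x hr hx
  have hpath : (fun a => decide (a.unpair.2 = q a.unpair.1)) ∈
      paths (constraintTree (b r) (C r)) :=
    mem_paths_constraintTree.2 ⟨fun i => ⟨q i, hqb i, by simp⟩, fun a c ha hc => by
      have hCac := hqC a.unpair.1 c.unpair.1
      rwa [← of_decide_eq_true ha, ← of_decide_eq_true hc] at hCac⟩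
  refine ⟨_, infinite_of_mem_paths hpath, treeRep_isName _, fun p z hz hpz => ?_⟩
  obtain ⟨hbound, hconstraint⟩ := mem_paths_constraintTree.1 hz
  have htrue : ∀ a, p a = 1 ↔ z a = true := fun a => by rw [hpz a]; simp
  refine ⟨fun n => ?_, fun r' hr' => hsound r' fun i j => ?_⟩
  · obtain ⟨k, -, hk⟩ := hbound n
    exact ⟨k, 0, (htrue _).2 hk⟩
  · have hbit : ∀ n, z (Nat.pair n (r' n)) = true := fun n => (htrue _).1 (hr' n).choose_spec
    simpa using hconstraint _ _ (hbit i) (hbit j)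

/-! ### Rational numbers and points computed from an oracle -/

/-- Rational valued functions whose values are computed with an oracle, as differences of
numerators over a positive denominator. The values are taken as real numbers, so that the
comparisons decided by `OracleRational.lt` and `OraclePoint.dist_lt` need no casts. -/
def OracleRational {α : Type} [Primcodable α] (f : Baire → α → ℝ) : Prop :=
  ∃ a b d : Baire → α → ℕ, OracleComputable a ∧ OracleComputable b ∧ OracleComputable d ∧
    ∀ p x, 0 < d p x ∧ f p x = ((a p x : ℝ) - b p x) / d p x

namespace OracleRational

variable {α : Type} [Primcodable α] {f g : Baire → α → ℝ} {u : Baire → α → ℕ}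

theorem of_eq (hf : OracleRational f) (h : ∀ p x, f p x = g p x) : OracleRational g :=
  (funext₂ h : f = g) ▸ hf

theorem natCast (hu : OracleComputable u) : OracleRational fun p x => (u p x : ℝ) :=
  ⟨u, fun _ _ => 0, fun _ _ => 1, hu, .const 0, .const 1, fun _ _ => by simp⟩

theorem const (c : ℕ) : OracleRational fun _ (_ : α) => (c : ℝ) := natCast (.const c)

theorem add (hf : OracleRational f) (hg : OracleRational g) :
    OracleRational fun p x => f p x + g p x := by
  obtain ⟨a, b, d, ha, hb, hd, hf⟩ := hf
  obtain ⟨a', b', d', ha', hb', hd', hg⟩ := hg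
  refine ⟨fun p x => a p x * d' p x + a' p x * d p x, fun p x => b p x * d' p x + b' p x * d p x,
    fun p x => d p x * d' p x,
    .primrec₂_comp .nat_add (.primrec₂_comp .nat_mul ha hd') (.primrec₂_comp .nat_mul ha' hd),
    .primrec₂_comp .nat_add (.primrec₂_comp .nat_mul hb hd') (.primrec₂_comp .nat_mul hb' hd),
    .primrec₂_comp .nat_mul hd hd', fun p x => ?_⟩
  obtain ⟨hpos, hfx⟩ := hf p x
  obtain ⟨hpos', hgx⟩ := hg p x
  refine ⟨Nat.mul_pos hpos hpos', ?_⟩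
  beta_reduce
  rw [hfx, hgx, div_add_div _ _ (by positivity) (by positivity)]
  push_cast
  ring

theorem neg (hf : OracleRational f) : OracleRational fun p x => -f p x := by
  obtain ⟨a, b, d, ha, hb, hd, hf⟩ := hf
  refine ⟨b, a, d, hb, ha, hd, fun p x => ⟨(hf p x).1, ?_⟩⟩
  beta_reduce
  rw [(hf p x).2, ← neg_div, neg_sub]

theorem sub (hf : OracleRational f) (hg : OracleRational g) :
    OracleRational fun p x => f p x - g p x :=
  (hf.add hg.neg).of_eq fun _ _ => (sub_eq_add_neg _ _).symm

theorem mul (hf : OracleRational f) (hg : OracleRational g) :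
    OracleRational fun p x => f p x * g p x := by
  obtain ⟨a, b, d, ha, hb, hd, hf⟩ := hf
  obtain ⟨a', b', d', ha', hb', hd', hg⟩ := hg
  refine ⟨fun p x => a p x * a' p x + b p x * b' p x, fun p x => a p x * b' p x + b p x * a' p x,
    fun p x => d p x * d' p x,
    .primrec₂_comp .nat_add (.primrec₂_comp .nat_mul ha ha') (.primrec₂_comp .nat_mul hb hb'),
    .primrec₂_comp .nat_add (.primrec₂_comp .nat_mul ha hb') (.primrec₂_comp .nat_mul hb ha'),
    .primrec₂_comp .nat_mul hd hd', fun p x => ?_⟩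
  obtain ⟨hpos, hfx⟩ := hf p x
  obtain ⟨hpos', hgx⟩ := hg p x
  refine ⟨Nat.mul_pos hpos hpos', ?_⟩
  beta_reduce
  rw [hfx, hgx, div_mul_div_comm]
  push_cast
  ring

theorem inv (hf : OracleRational f) (hpos : ∀ p x, 0 < f p x) :
    OracleRational fun p x => (f p x)⁻¹ := by
  obtain ⟨a, b, d, ha, hb, hd, hf⟩ := hf
  refine ⟨d, fun _ _ => 0, fun p x => a p x - b p x, hd, .const 0,
    .primrec₂_comp .nat_sub ha hb, fun p x => ?_⟩
  obtain ⟨hdpos, hfx⟩ := hf p x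
  have hba : b p x < a p x := by
    have := hpos p x
    rwa [hfx, div_pos_iff_of_pos_right (by positivity), sub_pos, Nat.cast_lt] at this
  refine ⟨Nat.sub_pos_of_lt hba, ?_⟩
  beta_reduce
  rw [hfx, inv_div, Nat.cast_sub hba.le, Nat.cast_zero, sub_zero]

theorem div (hf : OracleRational f) (hg : OracleRational g) (hpos : ∀ p x, 0 < g p x) :
    OracleRational fun p x => f p x / g p x :=
  (hf.mul (hg.inv hpos)).of_eq fun _ _ => (div_eq_mul_inv _ _).symm

theorem sq (hf : OracleRational f) : OracleRational fun p x => f p x ^ 2 :=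
  (hf.mul hf).of_eq fun _ _ => (pow_two _).symm

theorem inv_pow (c : ℕ) [c.AtLeastTwo] (hu : OracleComputable u) :
    OracleRational fun p x => (OfNat.ofNat c : ℝ)⁻¹ ^ u p x := by
  have hpow : OracleComputable fun p x => c ^ u p x :=
    .primrec₂_comp (Primrec₂.unpaired'.1 Nat.Primrec.pow) (.const c) hu
  have hc : 0 < c := Nat.pos_of_ne_zero (NeZero.ne c)
  exact ((natCast hpow).inv fun p x => by positivity).of_eq fun p x => by
    rw [Nat.cast_pow, _root_.inv_pow]
    rfl

theorem sum {ι : Type*} (s : Finset ι) {F : ι → Baire → α → ℝ}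
    (hF : ∀ i, OracleRational (F i)) : OracleRational fun p x => ∑ i ∈ s, F i p x := by
  classical
  induction s using Finset.induction_on with
  | empty => exact (const 0).of_eq fun _ _ => by simp
  | insert i s hi ih => exact ((hF i).add ih).of_eq fun p x => by rw [Finset.sum_insert hi]

theorem ratNum (hu : OracleComputable u) :
    OracleRational fun p x => (Wei.ratNum (u p x) : ℝ) := by
  have hnum := hu.unpair.fst.unpair
  refine (((natCast hnum.fst).sub (natCast hnum.snd)).div
    ((natCast hu.unpair.snd).add (const 1)) fun p x => by positivity).of_eq fun p x => ?_
  simp [Wei.ratNum]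

theorem nonnegRatNum (hu : OracleComputable u) :
    OracleRational fun p x => (Wei.nonnegRatNum (u p x) : ℝ) := by
  refine ((natCast hu.unpair.fst).div
    ((natCast hu.unpair.snd).add (const 1)) fun p x => by positivity).of_eq fun p x => ?_
  simp [Wei.nonnegRatNum]

theorem lt (hf : OracleRational f) (hg : OracleRational g) :
    OracleDecidable fun p x => f p x < g p x := by
  obtain ⟨a, b, d, ha, hb, hd, hf⟩ := hf
  obtain ⟨a', b', d', ha', hb', hd', hg⟩ := hg
  refine (OracleDecidable.nat_lt
    (.primrec₂_comp .nat_add (.primrec₂_comp .nat_mul ha hd') (.primrec₂_comp .nat_mul hb' hd))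
    (.primrec₂_comp .nat_add (.primrec₂_comp .nat_mul ha' hd) (.primrec₂_comp .nat_mul hb hd'))
    ).of_iff fun p x => ?_
  obtain ⟨hpos, hfx⟩ := hf p x
  obtain ⟨hpos', hgx⟩ := hg p x
  rw [hfx, hgx, div_lt_div_iff₀ (by positivity) (by positivity), ← Nat.cast_lt (α := ℝ)]
  push_cast
  constructor <;> intro h <;> linarith

theorem le (hf : OracleRational f) (hg : OracleRational g) :
    OracleDecidable fun p x => f p x ≤ g p x :=
  (hg.lt hf).not.of_iff fun _ _ => not_lt

end OracleRational

/-- Functions into Euclidean space whose values are points with rational coordinates that are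
computed with an oracle. -/
def OraclePoint {α : Type} [Primcodable α] {n : ℕ} (f : Baire → α → Euc n) : Prop :=
  ∀ i, OracleRational fun p x => f p x i

namespace OraclePoint

variable {α : Type} [Primcodable α] {n : ℕ} {f g : Baire → α → Euc n} {r : Baire → α → ℝ}

theorem ratPoint {u : Baire → α → ℕ} (hu : OracleComputable u) :
    OraclePoint fun p x => ratPoint n (u p x) := by
  have hentry : ∀ (i : ℕ) {u : Baire → α → ℕ}, OracleComputable u →
      OracleComputable fun p x => entry i (u p x) := by
    intro i u hu
    induction i generalizing u with
    | zero => exact hu.unpair.fst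
    | succ _ ih => exact ih hu.unpair.snd
  exact fun i => .ratNum (hentry i hu)

theorem smul (hr : OracleRational r) (hf : OraclePoint f) : OraclePoint fun p x => r p x • f p x :=
  fun i => hr.mul (hf i)

theorem dist_sq (hf : OraclePoint f) (hg : OraclePoint g) :
    OracleRational fun p x => dist (f p x) (g p x) ^ 2 :=
  (OracleRational.sum Finset.univ fun i => ((hf i).sub (hg i)).sq).of_eq fun p x => by
    simp [EuclideanSpace.dist_sq_eq, Real.dist_eq]

theorem dist_lt (hf : OraclePoint f) (hg : OraclePoint g) (hr : OracleRational r) :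
    OracleDecidable fun p x => dist (f p x) (g p x) < r p x :=
  (((OracleRational.const 0).lt hr).and ((hf.dist_sq hg).lt hr.sq)).of_iff fun p x => by
    rw [Nat.cast_zero]
    exact ⟨fun h => lt_of_pow_lt_pow_left₀ 2 h.1.le h.2,
      fun h => ⟨dist_nonneg.trans_lt h, by gcongr⟩⟩

theorem dist_le (hf : OraclePoint f) (hg : OraclePoint g) (hr : OracleRational r) :
    OracleDecidable fun p x => dist (f p x) (g p x) ≤ r p x :=
  (((OracleRational.const 0).le hr).and ((hf.dist_sq hg).le hr.sq)).of_iff fun p x => by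
    rw [Nat.cast_zero]
    exact ⟨fun h => le_of_sq_le_sq h.2 h.1, fun h => ⟨dist_nonneg.trans h, by gcongr⟩⟩

theorem le_dist (hf : OraclePoint f) (hg : OraclePoint g) (hr : OracleRational r) :
    OracleDecidable fun p x => r p x ≤ dist (f p x) (g p x) :=
  (hf.dist_lt hg hr).not.of_iff fun _ _ => not_lt

end OraclePoint

/-! ### Names of points and balls -/

/-- The centre of the basic ball with the code `k`. -/
def ballCenter (n k : ℕ) : Euc n := ratPoint n k.unpair.1

/-- The radius of the basic ball with the code `k`. -/
def ballRadius (k : ℕ) : ℝ := nonnegRatNum k.unpair.2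

theorem mem_basicBall_iff {n k : ℕ} {x : Euc n} :
    x ∈ basicBall n k ↔ dist x (ballCenter n k) < ballRadius k := Iff.rfl

theorem OraclePoint.ballCenter {α : Type} [Primcodable α] {u : Baire → α → ℕ} (n : ℕ)
    (hu : OracleComputable u) : OraclePoint fun p x => ballCenter n (u p x) :=
  .ratPoint hu.unpair.fst

theorem OracleRational.ballRadius {α : Type} [Primcodable α] {u : Baire → α → ℕ}
    (hu : OracleComputable u) : OracleRational fun p x => ballRadius (u p x) :=
  .nonnegRatNum hu.unpair.snd

theorem exists_nonnegRatNum_btwn {a b : ℝ} (ha : 0 ≤ a) (hab : a < b) :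
    ∃ k, a < nonnegRatNum k ∧ nonnegRatNum k < b := by
  obtain ⟨q, haq, hqb⟩ := exists_rat_btwn hab
  obtain ⟨k, rfl⟩ := nonnegRatNum_surj (q := q) (by exact_mod_cast ha.trans haq.le)
  exact ⟨k, haq, hqb⟩

theorem exists_mem_basicBall_radius_lt {n : ℕ} (x : Euc n) {ε : ℝ} (hε : 0 < ε) :
    ∃ k, x ∈ basicBall n k ∧ ballRadius k < ε := by
  obtain ⟨b, hb, hbε⟩ := exists_nonnegRatNum_btwn le_rfl hε
  obtain ⟨a, ha⟩ := (ratPoint_dense n).exists_dist_lt x hb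
  exact ⟨Nat.pair a b, by simpa [basicBall] using ha, by simpa [ballRadius] using hbε⟩

theorem exists_two_inv_pow_lt {ε : ℝ} (hε : 0 < ε) : ∃ i : ℕ, (2 : ℝ)⁻¹ ^ i < ε :=
  exists_pow_lt_of_lt_one hε (by norm_num)

section CauchyNames

variable {n : ℕ} {q : Baire} {y : Euc n}

theorem dist_ratPoint_le_of_isName (hq : (cauchyRep n).IsName q y) (i : ℕ) :
    dist (ratPoint n (q i)) y ≤ (2 : ℝ)⁻¹ ^ i :=
  le_of_tendsto (tendsto_const_nhds.dist hq.2) (eventually_atTop.2 ⟨i, fun j hj => by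
    simpa using hq.1 i j hj⟩)

theorem exists_isName_of_dist_le
    (hq : ∀ i j, i ≤ j → dist (ratPoint n (q i)) (ratPoint n (q j)) ≤ (2 : ℝ)⁻¹ ^ i) :
    ∃ y, (cauchyRep n).IsName q y := by
  have hcauchy : CauchySeq fun i => ratPoint n (q i) :=
    cauchySeq_of_le_tendsto_0' _ hq
      (tendsto_pow_atTop_nhds_zero_of_lt_one (by norm_num) (by norm_num))
  obtain ⟨y, hy⟩ := cauchySeq_tendsto_of_complete hcauchy
  exact ⟨y, hq, hy⟩

theorem isName_of_dist_le_half (hq : ∀ i, dist (ratPoint n (q i)) y ≤ (2 : ℝ)⁻¹ ^ i / 2) :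
    (cauchyRep n).IsName q y := by
  refine ⟨fun i j hij => ?_, ?_⟩
  · have htri := dist_triangle_right (ratPoint n (q i)) (ratPoint n (q j)) y
    have hpow : (2 : ℝ)⁻¹ ^ j ≤ (2 : ℝ)⁻¹ ^ i :=
      pow_le_pow_of_le_one (by norm_num) (by norm_num) hij
    linarith [hq i, hq j]
  · rw [tendsto_iff_dist_tendsto_zero]
    refine squeeze_zero (fun _ => dist_nonneg) hq ?_
    simpa using (tendsto_pow_atTop_nhds_zero_of_lt_one (r := (2 : ℝ)⁻¹) (by norm_num)
      (by norm_num)).div_const 2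

theorem dist_lt_iff_of_isName (hq : (cauchyRep n).IsName q y) {z : Euc n} {t : ℝ} :
    dist y z < t ↔ ∃ i, dist (ratPoint n (q i)) z < t - (2 : ℝ)⁻¹ ^ i := by
  constructor
  · intro h
    obtain ⟨i, hi⟩ := exists_two_inv_pow_lt (ε := (t - dist y z) / 2) (by linarith)
    have htri := dist_triangle (ratPoint n (q i)) y z
    exact ⟨i, by linarith [dist_ratPoint_le_of_isName hq i]⟩
  · rintro ⟨i, hi⟩
    have htri := dist_triangle_left y z (ratPoint n (q i))
    linarith [dist_ratPoint_le_of_isName hq i]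

end CauchyNames

/-! ### Computable bounds for the codes in a name -/

theorem pair_le_pair {a b c d : ℕ} (h : a ≤ c) (h' : b ≤ d) : Nat.pair a b ≤ Nat.pair c d :=
  ((StrictMono.monotone fun _ _ h => Nat.pair_lt_pair_left b h) h).trans
    ((StrictMono.monotone fun _ _ h => Nat.pair_lt_pair_right c h) h')

theorem entry_le (i k : ℕ) : entry i k ≤ k := by
  induction i generalizing k with
  | zero => exact Nat.unpair_left_le k
  | succ i ih => exact (ih _).trans (Nat.unpair_right_le k)

theorem abs_ratNum_le (k : ℕ) : |ratNum k| ≤ k := by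
  have hplus : (k.unpair.1.unpair.1 : ℚ) ≤ k := by
    exact_mod_cast (Nat.unpair_left_le _).trans (Nat.unpair_left_le _)
  have hminus : (k.unpair.1.unpair.2 : ℚ) ≤ k := by
    exact_mod_cast (Nat.unpair_right_le _).trans (Nat.unpair_left_le _)
  rw [ratNum, abs_div, abs_of_pos (by positivity : (0 : ℚ) < k.unpair.2 + 1)]
  refine (div_le_self (abs_nonneg _) (by simp)).trans (abs_sub_le_of_nonneg_of_le ?_ ?_ ?_ ?_)
  all_goals first | assumption | positivity

theorem ballRadius_le (k : ℕ) : ballRadius k ≤ k := by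
  have hnum : (k.unpair.2.unpair.1 : ℝ) ≤ k := by
    exact_mod_cast (Nat.unpair_left_le _).trans (Nat.unpair_right_le _)
  simp only [ballRadius, nonnegRatNum, Rat.cast_div, Rat.cast_natCast, Rat.cast_add, Rat.cast_one]
  exact (div_le_self (Nat.cast_nonneg _) (by simp)).trans hnum

theorem norm_le_mul_of_abs_le {n : ℕ} {x : Euc n} {c : ℝ} (h : ∀ i, |x i| ≤ c) :
    ‖x‖ ≤ n * c := by
  have hsum : ‖x‖ ≤ ∑ i, |x i| := by
    rw [EuclideanSpace.norm_eq]
    exact Real.sqrt_le_iff.2 ⟨Finset.sum_nonneg fun _ _ => abs_nonneg _,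
      Finset.sum_sq_le_sq_sum_of_nonneg fun _ _ => norm_nonneg _⟩
  simpa using hsum.trans (Finset.sum_le_card_nsmul _ _ c fun i _ => h i)

theorem norm_ratPoint_le (n k : ℕ) : ‖ratPoint n k‖ ≤ n * k := by
  refine norm_le_mul_of_abs_le fun i => ?_
  have hcoord : |ratNum (entry i k)| ≤ k :=
    (abs_ratNum_le _).trans (by exact_mod_cast entry_le i k)
  simpa [ratPoint] using (Rat.cast_le (K := ℝ)).2 hcoord

/-- A bound for the codes of the sequences of length `n` with entries at most `C`. -/
def seqCodeBound : ℕ → ℕ → ℕ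
  | 0, _ => 0
  | n + 1, C => Nat.pair C (seqCodeBound n C)

theorem primrec_seqCodeBound (n : ℕ) : Primrec (seqCodeBound n) := by
  induction n with
  | zero => exact .const 0
  | succ n ih => exact Primrec₂.natPair.comp .id ih

theorem exists_le_seqCodeBound_entry_eq (n C : ℕ) (v : ℕ → ℕ) (hv : ∀ i < n, v i ≤ C) :
    ∃ k ≤ seqCodeBound n C, ∀ i < n, entry i k = v i := by
  induction n generalizing v with
  | zero => exact ⟨0, le_rfl, fun i hi => absurd hi (Nat.not_lt_zero i)⟩
  | succ n ih =>
    obtain ⟨k, hkb, hk⟩ := ih (fun i => v (i + 1)) fun i hi => hv _ (by omega)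
    refine ⟨Nat.pair (v 0) k, pair_le_pair (hv 0 (by omega)) hkb, fun i hi => ?_⟩
    cases i with
    | zero => simp [entry]
    | succ i => simpa [entry] using hk i (by omega)

/-- A bound for the codes of fractions with the denominator `N + 1` that approximate the numbers
in `[-M, M]` up to `1 / (N + 1)`. -/
def ratCodeBound (M N : ℕ) : ℕ :=
  Nat.pair (Nat.pair (2 * M * (N + 1)) (M * (N + 1))) N

theorem exists_le_ratCodeBound_near {M : ℕ} (N : ℕ) {t : ℝ} (ht : |t| ≤ M) :
    ∃ k ≤ ratCodeBound M N, |(ratNum k : ℝ) - t| ≤ 1 / (N + 1) := by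
  obtain ⟨hlower, hupper⟩ := abs_le.1 ht
  -- The numerator `⌊t (N + 1)⌋` is shifted by `M (N + 1)` to make it a natural number.
  set a : ℝ := (t + M) * (N + 1) with ha
  have ha0 : 0 ≤ a := mul_nonneg (by linarith) (by positivity)
  have hfloor : ⌊a⌋₊ ≤ 2 * M * (N + 1) := by
    refine Nat.floor_le_of_le ?_
    push_cast
    exact mul_le_mul_of_nonneg_right (by linarith) (by positivity)
  refine ⟨Nat.pair (Nat.pair ⌊a⌋₊ (M * (N + 1))) N,
    pair_le_pair (pair_le_pair hfloor le_rfl) le_rfl, ?_⟩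
  have herr : (ratNum (Nat.pair (Nat.pair ⌊a⌋₊ (M * (N + 1))) N) : ℝ) - t =
      (⌊a⌋₊ - a) / (N + 1) := by
    simp only [ratNum, Nat.unpair_pair]
    push_cast
    rw [ha]
    field_simp
    ring
  rw [herr, abs_div, abs_of_pos (by positivity : (0 : ℝ) < N + 1)]
  gcongr
  rw [abs_le]
  constructor <;> linarith [Nat.floor_le ha0, Nat.lt_floor_add_one a]

theorem exists_le_seqCodeBound_near {n M : ℕ} (N : ℕ) {y : Euc n} (hy : ‖y‖ ≤ M) :
    ∃ k ≤ seqCodeBound n (ratCodeBound M N), dist (ratPoint n k) y ≤ n * (1 / (N + 1)) := by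
  choose c hcb hc using fun i : Fin n =>
    exists_le_ratCodeBound_near N ((PiLp.norm_apply_le y i).trans hy)
  obtain ⟨k, hkb, hk⟩ := exists_le_seqCodeBound_entry_eq n _
    (fun i => if h : i < n then c ⟨i, h⟩ else 0) fun i hi => by simpa [hi] using hcb ⟨i, hi⟩
  refine ⟨k, hkb, ?_⟩
  rw [dist_eq_norm]
  refine norm_le_mul_of_abs_le fun i => ?_
  simpa [ratPoint, hk i i.2] using hc i

/-- A strict bound for the entry `i` of a suitable Cauchy name of any point of norm at most `M`. -/
def nameBound (n M i : ℕ) : ℕ := seqCodeBound n (ratCodeBound M (n * 2 ^ (i + 1))) + 1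

theorem exists_isName_lt_nameBound {n M : ℕ} {y : Euc n} (hy : ‖y‖ ≤ M) :
    ∃ q, (cauchyRep n).IsName q y ∧ ∀ i, q i < nameBound n M i := by
  choose q hqb hq using fun i => exists_le_seqCodeBound_near (n * 2 ^ (i + 1)) hy
  refine ⟨q, isName_of_dist_le_half fun i => (hq i).trans ?_, fun i => Nat.lt_succ_of_le (hqb i)⟩
  push_cast
  rw [mul_one_div, div_le_iff₀ (by positivity), inv_pow, pow_succ]
  have hcancel : ((2 : ℝ) ^ i)⁻¹ / 2 * (n * (2 ^ i * 2)) = n := by field_simp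
  rw [mul_add, hcancel]
  exact le_add_of_nonneg_right (by positivity)

theorem oracleComputable_nameBound {α : Type} [Primcodable α] (n : ℕ) {M i : Baire → α → ℕ}
    (hM : OracleComputable M) (hi : OracleComputable i) :
    OracleComputable fun p x => nameBound n (M p x) (i p x) := by
  have hN : OracleComputable fun p x => n * 2 ^ (i p x + 1) :=
    .primrec₂_comp .nat_mul (.const n)
      (.primrec₂_comp (Primrec₂.unpaired'.1 Nat.Primrec.pow) (.const 2) (.primrec_comp .succ hi))
  have hden := hN.primrec_comp .succ
  have hnum : OracleComputable fun p x =>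
      Nat.pair (2 * M p x * (n * 2 ^ (i p x + 1) + 1)) (M p x * (n * 2 ^ (i p x + 1) + 1)) :=
    .primrec₂_comp .natPair
      (.primrec₂_comp .nat_mul (.primrec₂_comp .nat_mul (.const 2) hM) hden)
      (.primrec₂_comp .nat_mul hM hden)
  have hrat := OracleComputable.primrec₂_comp Primrec₂.natPair hnum hN
  exact .primrec_comp .succ (.primrec_comp (primrec_seqCodeBound n) hrat)

/-! ### Names of projection points -/

theorem mem_projPoints_iff {X : Type} [MetricSpace X] {x y : X} {A : Set X} (hA : A.Nonempty) :
    y ∈ projPoints x A ↔ y ∈ A ∧ ∀ z ∈ A, dist x y ≤ dist x z :=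
  and_congr_right fun hy =>
    ⟨fun h _ hz => h.le.trans (Metric.infDist_le_dist_of_mem hz), fun h =>
      ((Metric.le_infDist hA).2 fun {_} hz => h _ hz).antisymm
        (Metric.infDist_le_dist_of_mem hy)⟩

section Projection

variable {n : ℕ} {p q neg pos : Baire} {x y : Euc n} {A : Set (Euc n)}

theorem norm_le_of_mem_projPoints (hp : (cauchyRep n).IsName p x) (hpos : PosName n pos A)
    (hy : y ∈ projPoints x A) : ‖y‖ ≤ (2 * n * p 0 + (n + 1) * pos 0 + 2 : ℕ) := by
  obtain ⟨a, hab, haA⟩ := (hpos (pos 0)).1 ⟨0, rfl⟩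
  have hxy : dist x y ≤ dist x a := ((mem_projPoints_iff ⟨a, haA⟩).1 hy).2 a haA
  have hx : dist (ratPoint n (p 0)) x ≤ 1 := by simpa using dist_ratPoint_le_of_isName hp 0
  have hp0 : dist (ratPoint n (p 0)) 0 ≤ n * p 0 := by
    simpa using norm_ratPoint_le n (p 0)
  have hcenter : dist (ballCenter n (pos 0)) 0 ≤ n * pos 0 := by
    rw [dist_zero_right]
    refine (norm_ratPoint_le n _).trans ?_
    gcongr
    exact Nat.unpair_left_le _
  have ha : dist a (ballCenter n (pos 0)) ≤ pos 0 :=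
    (mem_basicBall_iff.1 hab).le.trans (ballRadius_le _)
  have hynorm := dist_triangle4 y x (ratPoint n (p 0)) 0
  have hxa := dist_triangle4 x (ratPoint n (p 0)) (ballCenter n (pos 0)) a
  have hcc := dist_triangle_right (ratPoint n (p 0)) (ballCenter n (pos 0)) 0
  rw [dist_comm y x, dist_comm x (ratPoint n (p 0))] at hynorm
  rw [dist_comm x (ratPoint n (p 0)), dist_comm (ballCenter n (pos 0)) a] at hxa
  rw [← dist_zero_right]
  push_cast
  linarith

theorem NegName.mem_iff_of_isName (hneg : NegName n neg A) (hq : (cauchyRep n).IsName q y) :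
    y ∈ A ↔ ∀ i j,
      ballRadius (neg j) - (2 : ℝ)⁻¹ ^ i ≤ dist (ratPoint n (q i)) (ballCenter n (neg j)) := by
  have hmem : y ∈ A ↔ ∀ j, y ∉ basicBall n (neg j) := by
    unfold NegName at hneg
    rw [hneg]
    simp
  simp only [hmem, mem_basicBall_iff, dist_lt_iff_of_isName hq, not_exists, not_lt]
  exact forall_comm

/-- Entry `i` of the name `q` is not seen to be farther from entry `i` of the name `p` than the
ball with the code `k`, by means of the rational upper bound with the code `t` for the distance of
the latter from the centre of the ball. The bound `t` is there because the inequality is then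
decided without adding square roots. -/
def NotSeenFarther (n : ℕ) (p q : Baire) (i k t : ℕ) : Prop :=
  dist (ratPoint n (p i)) (ballCenter n k) < nonnegRatNum t →
    dist (ratPoint n (p i)) (ratPoint n (q i)) ≤
      nonnegRatNum t + ballRadius k + 3 * (2 : ℝ)⁻¹ ^ i

theorem mem_projPoints_iff_of_isName (hp : (cauchyRep n).IsName p x) (hpos : PosName n pos A)
    (hq : (cauchyRep n).IsName q y) (hy : y ∈ A) :
    y ∈ projPoints x A ↔ ∀ i u t, NotSeenFarther n p q i (pos u) t := by
  rw [mem_projPoints_iff ⟨y, hy⟩, and_iff_right hy]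
  constructor
  · intro hnearest i u t ht
    obtain ⟨z, hzb, hzA⟩ := (hpos (pos u)).1 ⟨u, rfl⟩
    rw [mem_basicBall_iff] at hzb
    have hpq := dist_triangle4 (ratPoint n (p i)) x y (ratPoint n (q i))
    have hxz := dist_triangle4 x (ratPoint n (p i)) (ballCenter n (pos u)) z
    rw [dist_comm y] at hpq
    rw [dist_comm x (ratPoint n (p i)), dist_comm (ballCenter n (pos u)) z] at hxz
    linarith [hnearest z hzA, dist_ratPoint_le_of_isName hp i, dist_ratPoint_le_of_isName hq i]
  · intro hseen z hzA
    refine le_of_forall_pos_le_add fun ε hε => ?_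
    obtain ⟨k, hzk, hk⟩ := exists_mem_basicBall_radius_lt z (ε := ε / 9) (by positivity)
    obtain ⟨u, rfl⟩ := (hpos k).2 ⟨z, hzk, hzA⟩
    obtain ⟨i, hi⟩ := exists_two_inv_pow_lt (ε := ε / 9) (by positivity)
    obtain ⟨t, hlt, htlt⟩ := exists_nonnegRatNum_btwn
      (dist_nonneg (x := ratPoint n (p i)) (y := ballCenter n (pos u)))
      (lt_add_of_pos_right _ (by positivity : 0 < ε / 9))
    have hfar := hseen i u t hlt
    rw [mem_basicBall_iff] at hzk
    have hxy := dist_triangle4 x (ratPoint n (p i)) (ratPoint n (q i)) y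
    have hpc := dist_triangle4 (ratPoint n (p i)) x z (ballCenter n (pos u))
    rw [dist_comm x (ratPoint n (p i))] at hxy
    linarith [dist_ratPoint_le_of_isName hp i, dist_ratPoint_le_of_isName hq i]

theorem projPoints_nonempty (x : Euc n) (hclosed : IsClosed A) (hA : A.Nonempty) :
    (projPoints x A).Nonempty := by
  obtain ⟨y, hy, hxy⟩ := hclosed.exists_infDist_eq_dist hA x
  exact ⟨y, hy, hxy.symm⟩

end Projection

/-- The constraints on the values `k` and `l` of a Cauchy name at `i` and `j` which together say
that the name denotes a projection point, for the problem instance with the name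
`r = ⟨p, ⟨neg, pos⟩⟩`. -/
def ProjConstraint (n : ℕ) (r : Baire) (a b : ℕ × ℕ) : Prop :=
  (a.1 ≤ b.1 → dist (ratPoint n a.2) (ratPoint n b.2) ≤ (2 : ℝ)⁻¹ ^ a.1) ∧
  ballRadius (r (4 * b.1 + 1)) - (2 : ℝ)⁻¹ ^ a.1 ≤
    dist (ratPoint n a.2) (ballCenter n (r (4 * b.1 + 1))) ∧
  NotSeenFarther n (fun i => r (2 * i)) (fun _ => a.2) a.1 (r (4 * b.1.unpair.1 + 3))
    b.1.unpair.2

theorem oracleDecidable_projConstraint (n : ℕ) :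
    OracleDecidable fun r (z : (ℕ × ℕ) × ℕ × ℕ) => ProjConstraint n r z.1 z.2 := by
  have hi : OracleComputable fun _ (z : (ℕ × ℕ) × ℕ × ℕ) => z.1.1 := .fst (.fst .id)
  have hj : OracleComputable fun _ (z : (ℕ × ℕ) × ℕ × ℕ) => z.2.1 := .fst (.snd .id)
  have hk : OraclePoint fun _ (z : (ℕ × ℕ) × ℕ × ℕ) => ratPoint n z.1.2 :=
    .ratPoint (.snd (.fst .id))
  have hl : OraclePoint fun _ (z : (ℕ × ℕ) × ℕ × ℕ) => ratPoint n z.2.2 :=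
    .ratPoint (.snd (.snd .id))
  have hp : OraclePoint fun r (z : (ℕ × ℕ) × ℕ × ℕ) => ratPoint n (r (2 * z.1.1)) :=
    .ratPoint (.apply (.primrec₂_comp .nat_mul (.const 2) hi))
  have hpart : ∀ c {u : Baire → (ℕ × ℕ) × ℕ × ℕ → ℕ}, OracleComputable u →
      OracleComputable fun r z => r (4 * u r z + c) := fun c _ hu =>
    .apply (.primrec₂_comp .nat_add (.primrec₂_comp .nat_mul (.const 4) hu) (.const c))
  have hneg := hpart 1 hj
  have hpos := hpart 3 hj.unpair.fst
  have hpow := OracleRational.inv_pow 2 hi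
  have ht := OracleRational.nonnegRatNum hj.unpair.snd
  exact (((OracleDecidable.nat_le hi hj).imp (hk.dist_le hl hpow)).and
    ((hk.le_dist (.ballCenter n hneg) ((OracleRational.ballRadius hneg).sub hpow)).and
      ((hp.dist_lt (.ballCenter n hpos) ht).imp
        (hp.dist_le hk ((ht.add (.ballRadius hpos)).add ((OracleRational.const 3).mul hpow))))))

theorem forall_projConstraint_iff {n : ℕ} {p neg pos : Baire} {x : Euc n} {A : Set (Euc n)}
    (hp : (cauchyRep n).IsName p x) (hneg : NegName n neg A) (hpos : PosName n pos A)
    {q : Baire} :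
    (∀ i j, ProjConstraint n (join p (join neg pos)) (i, q i) (j, q j)) ↔
      ∃ y ∈ projPoints x A, (cauchyRep n).IsName q y := by
  have hrneg : ∀ j, join p (join neg pos) (4 * j + 1) = neg j := fun j => by
    rw [show 4 * j + 1 = 2 * (2 * j) + 1 by ring, join_odd, join_even]
  have hrpos : ∀ j, join p (join neg pos) (4 * j + 3) = pos j := fun j => by
    rw [show 4 * j + 3 = 2 * (2 * j + 1) + 1 by ring, join_odd, join_odd]
  simp only [ProjConstraint, hrneg, hrpos, join_even]
  constructor
  · intro h
    obtain ⟨y, hq⟩ := exists_isName_of_dist_le fun i j => (h i j).1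
    have hyA := (hneg.mem_iff_of_isName hq).2 fun i j => (h i j).2.1
    refine ⟨y, (mem_projPoints_iff_of_isName hp hpos hq hyA).2 fun i u t => ?_, hq⟩
    simpa [NotSeenFarther] using (h i (Nat.pair u t)).2.2
  · rintro ⟨y, hy, hq⟩ i j
    exact ⟨hq.1 i j, (hneg.mem_iff_of_isName hq).1 hy.1 i j,
      (mem_projPoints_iff_of_isName hp hpos hq hy.1).1 hy i _ _⟩

theorem strongWeihrauchLE_proj_WKL (n : ℕ) : StrongWeihrauchLE (Proj n) WKL := by
  refine strongWeihrauchLE_WKL_of_constraints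
    (b := fun r i => nameBound n (2 * n * r 0 + (n + 1) * r 3 + 2) i)
    (oracleComputable_nameBound n ?_ .id) (oracleDecidable_projConstraint n) ?_
  · exact .primrec₂_comp .nat_add (.primrec₂_comp .nat_add
      (.primrec₂_comp .nat_mul (.const (2 * n)) (.apply (.const 0)))
      (.primrec₂_comp .nat_mul (.const (n + 1)) (.apply (.const 3)))) (.const 2)
  · rintro _ ⟨x, A, hclosed, hA⟩ ⟨p, _, rfl, hp, neg, pos, rfl, hneg, hpos⟩ -
    refine ⟨?_, fun q hq => (forall_projConstraint_iff hp hneg hpos).1 hq⟩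
    obtain ⟨y, hy⟩ := projPoints_nonempty x hclosed hA
    obtain ⟨q, hq, hlt⟩ := exists_isName_lt_nameBound (norm_le_of_mem_projPoints hp hpos hy)
    exact ⟨q, hlt, (forall_projConstraint_iff hp hneg hpos).2 ⟨y, hy, hq⟩⟩

/-! ### Words as points near the unit circle -/

/-- The number whose octal digits are the bits of a word. Digits other than `0` and `1` are left
out, which separates the intervals of numbers whose expansions start with different words. -/
def wordNum (w : List Bool) : ℕ := Nat.ofDigits 8 (w.reverse.map Bool.toNat)

theorem wordNum_append (u v : List Bool) :
    wordNum (u ++ v) = 8 ^ v.length * wordNum u + wordNum v := by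
  simp [wordNum, Nat.ofDigits_append, add_comm]

theorem seven_mul_wordNum_lt (w : List Bool) : 7 * wordNum w < 8 ^ w.length := by
  induction w using List.reverseRecOn with
  | nil => simp [wordNum]
  | append_singleton w b ih =>
    have hb : wordNum [b] ≤ 1 := by simpa [wordNum] using Bool.toNat_le b
    rw [wordNum_append, List.length_append, List.length_singleton, pow_succ]
    omega

theorem wordNum_injective_of_length_eq {u v : List Bool} (hlen : u.length = v.length)
    (h : wordNum u = wordNum v) : u = v := by
  have hdigit : ∀ (w : List Bool), ∀ d ∈ w.reverse.map Bool.toNat, d < 8 := by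
    intro w d hd
    obtain ⟨b, -, rfl⟩ := List.mem_map.1 hd
    exact (Bool.toNat_lt b).trans (by norm_num)
  have hmap := Nat.ofDigits_inj_of_len_eq (by norm_num) (by simpa using hlen) (hdigit u)
    (hdigit v) h
  have hbit : Function.Injective Bool.toNat := Function.LeftInverse.injective Bool.ofNat_toNat
  exact List.reverse_injective (hbit.list_map hmap)

theorem primrec_wordNum : Primrec wordNum := by
  have hstep : Primrec₂ fun (_ : List Bool) (z : ℕ × ℕ) => z.1 + 8 * z.2 :=
    Primrec.nat_add.comp (Primrec.fst.comp .snd)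
      (Primrec.nat_mul.comp (.const 8) (Primrec.snd.comp .snd))
  have hdigits : Primrec fun w : List Bool => w.reverse.map Bool.toNat :=
    Primrec.list_map .list_reverse ((Primrec.dom_bool Bool.toNat).comp .snd)
  exact (Primrec.list_foldr hdigits (.const 0) hstep).of_eq fun w => by
    rw [wordNum, Nat.ofDigits_eq_foldr]
    rfl

/-- The number in the unit interval whose octal digits after the point are the bits of a word. -/
def wordParam (w : List Bool) : ℝ := wordNum w / 8 ^ w.length

theorem wordParam_nonneg (w : List Bool) : 0 ≤ wordParam w := by
  unfold wordParam
  positivity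

theorem wordParam_le (w : List Bool) : wordParam w ≤ 1 / 7 := by
  have h : (7 * wordNum w : ℝ) < 8 ^ w.length := by exact_mod_cast seven_mul_wordNum_lt w
  rw [wordParam, div_le_iff₀ (by positivity)]
  linarith

theorem abs_wordParam_le_one (w : List Bool) : |wordParam w| ≤ 1 := by
  rw [abs_of_nonneg (wordParam_nonneg w)]
  exact (wordParam_le w).trans (by norm_num)

theorem wordParam_append (u v : List Bool) :
    wordParam (u ++ v) = wordParam u + 8⁻¹ ^ u.length * wordParam v := by
  simp only [wordParam, wordNum_append, List.length_append, pow_add, inv_pow]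
  push_cast
  field_simp

theorem abs_wordParam_sub_le_of_prefix {u w : List Bool} (h : u <+: w) :
    |wordParam u - wordParam w| ≤ 8⁻¹ ^ u.length / 7 := by
  obtain ⟨v, rfl⟩ := h
  have hpow : (0 : ℝ) ≤ 8⁻¹ ^ u.length := by positivity
  rw [wordParam_append, sub_add_cancel_left, abs_neg,
    abs_of_nonneg (mul_nonneg hpow (wordParam_nonneg v)), div_eq_mul_one_div]
  gcongr
  exact wordParam_le v

theorem le_abs_wordParam_sub {u v : List Bool} (hlen : u.length = v.length) (h : u ≠ v) :
    8⁻¹ ^ u.length ≤ |wordParam u - wordParam v| := by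
  have hne : (wordNum u : ℤ) - wordNum v ≠ 0 := fun h0 =>
    h (wordNum_injective_of_length_eq hlen (by omega))
  have hone : (1 : ℝ) ≤ |(wordNum u : ℝ) - wordNum v| := by exact_mod_cast Int.one_le_abs hne
  rw [wordParam, wordParam, ← hlen, ← sub_div, abs_div,
    abs_of_pos (by positivity : (0 : ℝ) < 8 ^ u.length), inv_pow, ← one_div]
  gcongr

/-- The point with the given first two coordinates and zeros after them. -/
def planarPoint (n : ℕ) (a b : ℝ) : Euc n :=
  WithLp.toLp 2 fun i => if (i : ℕ) = 0 then a else if (i : ℕ) = 1 then b else 0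

/-- The rational parametrization of the unit circle in the plane of the first two coordinates. -/
def circleParam (n : ℕ) (t : ℝ) : Euc n :=
  planarPoint n (2 * t / (1 + t ^ 2)) ((1 - t ^ 2) / (1 + t ^ 2))

/-- The point of the unit circle coded by a word. -/
def circlePoint (n : ℕ) (w : List Bool) : Euc n := circleParam n (wordParam w)

/-- The point coded by a word, outside of the unit disc and nearer to it for longer words. -/
def levelPoint (n : ℕ) (w : List Bool) : Euc n :=
  (1 + (8 : ℝ)⁻¹ ^ w.length / 16) • circlePoint n w

theorem ratPoint_zero (n : ℕ) : ratPoint n 0 = 0 := by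
  ext i
  simp [ratPoint, Nat.le_zero.1 (entry_le i 0), ratNum]

theorem pow_length_le_of_prefix {u w : List Bool} (h : u <+: w) :
    (8 : ℝ)⁻¹ ^ w.length ≤ (8 : ℝ)⁻¹ ^ u.length :=
  pow_le_pow_of_le_one (by norm_num) (by norm_num) h.length_le

section Geometry

variable {n : ℕ} {s t : ℝ} {u v w : List Bool}

theorem planarPoint_sub (n : ℕ) (a b c d : ℝ) :
    planarPoint n a b - planarPoint n c d = planarPoint n (a - c) (b - d) := by
  ext i
  simp only [planarPoint, PiLp.sub_apply]
  split_ifs <;> simp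

theorem norm_planarPoint_sq (hn : 2 ≤ n) (a b : ℝ) : ‖planarPoint n a b‖ ^ 2 = a ^ 2 + b ^ 2 := by
  obtain ⟨m, rfl⟩ := Nat.exists_eq_add_of_le' hn
  simp [EuclideanSpace.norm_sq_eq, planarPoint, Fin.sum_univ_succ]

theorem norm_circleParam (hn : 2 ≤ n) (t : ℝ) : ‖circleParam n t‖ = 1 := by
  rw [← sq_eq_sq₀ (norm_nonneg _) zero_le_one, circleParam, norm_planarPoint_sq hn]
  field_simp
  ring

theorem dist_circleParam_sq (hn : 2 ≤ n) (s t : ℝ) :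
    dist (circleParam n s) (circleParam n t) ^ 2 =
      4 * (s - t) ^ 2 / ((1 + s ^ 2) * (1 + t ^ 2)) := by
  rw [dist_eq_norm, circleParam, circleParam, planarPoint_sub, norm_planarPoint_sq hn]
  field_simp
  ring

theorem dist_circleParam_le (hn : 2 ≤ n) (s t : ℝ) :
    dist (circleParam n s) (circleParam n t) ≤ 2 * |s - t| := by
  refine le_of_sq_le_sq ?_ (by positivity)
  rw [dist_circleParam_sq hn, mul_pow, sq_abs]
  refine (div_le_self (by positivity) ?_).trans (by norm_num)
  nlinarith [sq_nonneg s, sq_nonneg t, mul_nonneg (sq_nonneg s) (sq_nonneg t)]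

theorem abs_sub_le_dist_circleParam (hn : 2 ≤ n) (hs : |s| ≤ 1) (ht : |t| ≤ 1) :
    |s - t| ≤ dist (circleParam n s) (circleParam n t) := by
  refine le_of_sq_le_sq ?_ dist_nonneg
  rw [dist_circleParam_sq hn, sq_abs, le_div_iff₀ (by positivity), mul_comm]
  have hs' := (sq_le_one_iff_abs_le_one s).2 hs
  have ht' := (sq_le_one_iff_abs_le_one t).2 ht
  have hfour : (1 + s ^ 2) * (1 + t ^ 2) ≤ 4 := by nlinarith [sq_nonneg s, sq_nonneg t]
  gcongr

theorem dist_levelPoint_circlePoint (hn : 2 ≤ n) (w : List Bool) :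
    dist (levelPoint n w) (circlePoint n w) = (8 : ℝ)⁻¹ ^ w.length / 16 := by
  rw [dist_eq_norm, levelPoint, add_smul, one_smul, add_sub_cancel_left, norm_smul, circlePoint,
    norm_circleParam hn, mul_one, Real.norm_of_nonneg (by positivity)]

theorem dist_zero_levelPoint (hn : 2 ≤ n) (w : List Bool) :
    dist (ratPoint n 0) (levelPoint n w) = 1 + (8 : ℝ)⁻¹ ^ w.length / 16 := by
  rw [ratPoint_zero, dist_zero_left, levelPoint, norm_smul, circlePoint, norm_circleParam hn,
    mul_one, Real.norm_of_nonneg (by positivity)]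

theorem dist_circlePoint_le_of_prefix (hn : 2 ≤ n) (h : u <+: w) :
    dist (circlePoint n u) (circlePoint n w) ≤ (8 : ℝ)⁻¹ ^ u.length * (2 / 7) := by
  have hdist := dist_circleParam_le hn (wordParam u) (wordParam w)
  rw [circlePoint, circlePoint]
  linarith [abs_wordParam_sub_le_of_prefix h]

theorem le_dist_circlePoint (hn : 2 ≤ n) (hlen : u.length = v.length) (h : u ≠ v) :
    (8 : ℝ)⁻¹ ^ u.length ≤ dist (circlePoint n u) (circlePoint n v) :=
  (le_abs_wordParam_sub hlen h).trans
    (abs_sub_le_dist_circleParam hn (abs_wordParam_le_one u) (abs_wordParam_le_one v))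

theorem dist_levelPoint_circlePoint_le_of_prefix (hn : 2 ≤ n) (h : u <+: w) :
    dist (levelPoint n w) (circlePoint n u) ≤ (8 : ℝ)⁻¹ ^ u.length * (3 / 8) := by
  have htri := dist_triangle_right (levelPoint n w) (circlePoint n u) (circlePoint n w)
  have hpow : (0 : ℝ) ≤ 8⁻¹ ^ u.length := by positivity
  linarith [dist_levelPoint_circlePoint hn w, dist_circlePoint_le_of_prefix hn h,
    pow_length_le_of_prefix h]

theorem dist_levelPoint_le_of_prefix (hn : 2 ≤ n) (h : u <+: w) :
    dist (levelPoint n w) (levelPoint n u) ≤ (8 : ℝ)⁻¹ ^ u.length := by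
  have htri := dist_triangle_right (levelPoint n w) (levelPoint n u) (circlePoint n u)
  have hpow : (0 : ℝ) ≤ 8⁻¹ ^ u.length := by positivity
  linarith [dist_levelPoint_circlePoint hn u, dist_levelPoint_circlePoint_le_of_prefix hn h]

end Geometry

section Computability

variable {α : Type} [Primcodable α] {w : Baire → α → List Bool}

theorem OracleRational.wordParam (hw : OracleComputable w) :
    OracleRational fun p x => wordParam (w p x) :=
  ((OracleRational.natCast (.primrec_comp primrec_wordNum hw)).mul
    (.inv_pow 8 (.primrec_comp .list_length hw))).of_eq fun p x => by
      rw [Wei.wordParam, _root_.inv_pow, div_eq_mul_inv]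

theorem OraclePoint.planarPoint (n : ℕ) {a b : Baire → α → ℝ} (ha : OracleRational a)
    (hb : OracleRational b) : OraclePoint fun p x => planarPoint n (a p x) (b p x) := by
  intro i
  simp only [Wei.planarPoint]
  split_ifs
  · exact ha
  · exact hb
  · exact (OracleRational.const 0).of_eq fun _ _ => Nat.cast_zero

theorem OraclePoint.circlePoint (n : ℕ) (hw : OracleComputable w) :
    OraclePoint fun p x => circlePoint n (w p x) := by
  have ht := OracleRational.wordParam hw
  have hden := (OracleRational.const 1).add ht.sq
  have hpos : ∀ p x, 0 < ((1 : ℕ) : ℝ) + Wei.wordParam (w p x) ^ 2 := fun p x => by positivity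
  have hplanar := planarPoint n (((OracleRational.const 2).mul ht).div hden hpos)
    (((OracleRational.const 1).sub ht.sq).div hden hpos)
  exact fun i => (hplanar i).of_eq fun p x => by simp [Wei.circlePoint, circleParam]

theorem OraclePoint.levelPoint (n : ℕ) (hw : OracleComputable w) :
    OraclePoint fun p x => levelPoint n (w p x) := by
  have hfactor : OracleRational fun p x => 1 + (8 : ℝ)⁻¹ ^ (w p x).length / 16 :=
    ((OracleRational.const 1).add ((OracleRational.inv_pow 8 (.primrec_comp .list_length hw)).div
      (.const 16) fun _ _ => by norm_num)).of_eq fun p x => by norm_num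
  exact .smul hfactor (.circlePoint n hw)

end Computability

/-! ### The closed set coded by a tree -/

/-- The closure of the points coded by the words of a tree. -/
def treeSet (n : ℕ) (T : BinTree) : Set (Euc n) := closure (levelPoint n '' T.1)

theorem levelPoint_mem_treeSet {n : ℕ} {T : BinTree} {w : List Bool} (hw : w ∈ T.1) :
    levelPoint n w ∈ treeSet n T :=
  subset_closure (Set.mem_image_of_mem _ hw)

theorem exists_mem_length_eq {T : BinTree} (hT : T.1.Infinite) (m : ℕ) :
    ∃ w ∈ T.1, w.length = m := by
  obtain ⟨w, hw, hlen⟩ := hT.exists_notMem_finite (List.finite_length_lt Bool m)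
  exact ⟨w.take m, T.2 w hw _ (List.take_prefix m w),
    List.length_take_of_le (not_lt.1 hlen)⟩

theorem exists_map_range_eq {α : Type*} {w : ℕ → List α} (hlen : ∀ m, (w m).length = m)
    (hprefix : ∀ m, w m <+: w (m + 1)) : ∃ z : ℕ → α, ∀ m, (List.range m).map z = w m := by
  have hstep : ∀ m, ∃ a, w (m + 1) = w m ++ [a] := fun m => by
    obtain ⟨v, hv⟩ := hprefix m
    have hv1 : v.length = 1 := by
      have := congrArg List.length hv
      rw [List.length_append, hlen, hlen] at this
      omega
    obtain ⟨a, rfl⟩ := List.length_eq_one_iff.1 hv1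
    exact ⟨a, hv.symm⟩
  choose z hz using hstep
  refine ⟨z, fun m => ?_⟩
  induction m with
  | zero => exact (List.length_eq_zero_iff.1 (hlen 0)).symm
  | succ m ih => rw [List.range_succ, List.map_append, ih, List.map_singleton, hz]

/-- The word codes a point of the circle so near that no other word of the same length does. -/
def NearWord (n : ℕ) (y : Euc n) (w : List Bool) : Prop :=
  dist y (circlePoint n w) < (8 : ℝ)⁻¹ ^ w.length / 2

section Paths

variable {n : ℕ} {y : Euc n} {T : BinTree} {u v w : List Bool}

theorem NearWord.unique (hn : 2 ≤ n) (hu : NearWord n y u) (hv : NearWord n y v)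
    (hlen : u.length = v.length) : u = v := by
  by_contra h
  have htri := dist_triangle_left (circlePoint n u) (circlePoint n v) y
  unfold NearWord at hu hv
  rw [← hlen] at hv
  linarith [le_dist_circlePoint hn hlen h]

theorem NearWord.of_prefix (hn : 2 ≤ n) (hw : NearWord n y w) (h : u <+: w) : NearWord n y u := by
  rcases h.length_le.eq_or_lt with hlen | hlen
  · rwa [h.eq_of_length hlen]
  · have htri := dist_triangle_right y (circlePoint n u) (circlePoint n w)
    have hpow : (0 : ℝ) < 8⁻¹ ^ u.length := by positivity
    have hstep : (8 : ℝ)⁻¹ ^ w.length ≤ 8⁻¹ ^ (u.length + 1) :=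
      pow_le_pow_of_le_one (by norm_num) (by norm_num) hlen
    rw [pow_succ] at hstep
    unfold NearWord at *
    linarith [dist_circlePoint_le_of_prefix hn h]

theorem levelPoint_notMem_projPoints (hn : 2 ≤ n) (hT : T.1.Infinite) (w : List Bool) :
    levelPoint n w ∉ projPoints (ratPoint n 0) (treeSet n T) := by
  intro hw
  obtain ⟨v, hv, hlen⟩ := exists_mem_length_eq hT (w.length + 1)
  have hle := ((mem_projPoints_iff ⟨_, hw.1⟩).1 hw).2 _ (levelPoint_mem_treeSet hv)
  have hpow : (8 : ℝ)⁻¹ ^ (w.length + 1) < 8⁻¹ ^ w.length :=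
    pow_lt_pow_right_of_lt_one₀ (by norm_num) (by norm_num) (Nat.lt_succ_self _)
  rw [dist_zero_levelPoint hn, dist_zero_levelPoint hn, hlen] at hle
  linarith

theorem treeSet_subset (hn : 2 ≤ n) (T : BinTree) (m : ℕ) :
    treeSet n T ⊆ levelPoint n '' {w | w.length < m} ∪
      ⋃ w ∈ {w ∈ T.1 | w.length = m},
        Metric.closedBall (circlePoint n w) ((8 : ℝ)⁻¹ ^ m * (3 / 8)) := by
  refine closure_minimal ?_ (.union ?_ ?_)
  · rintro _ ⟨w, hw, rfl⟩
    rcases lt_or_ge w.length m with hlen | hlen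
    · exact .inl ⟨w, hlen, rfl⟩
    · have htake : (w.take m).length = m := List.length_take_of_le hlen
      have hprefix := List.take_prefix m w
      refine .inr (Set.mem_biUnion (x := w.take m) ⟨T.2 w hw _ hprefix, htake⟩ ?_)
      simpa only [htake, Metric.mem_closedBall] using
        dist_levelPoint_circlePoint_le_of_prefix hn hprefix
  · exact ((List.finite_length_lt Bool m).image _).isClosed
  · exact ((List.finite_length_eq Bool m).subset fun w hw => hw.2).isClosed_biUnion
      fun _ _ => Metric.isClosed_closedBall

theorem exists_nearWord (hn : 2 ≤ n) (hT : T.1.Infinite)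
    (hy : y ∈ projPoints (ratPoint n 0) (treeSet n T)) (m : ℕ) :
    ∃ w ∈ T.1, w.length = m ∧ NearWord n y w := by
  rcases treeSet_subset hn T m hy.1 with ⟨w, -, rfl⟩ | hmem
  · exact absurd hy (levelPoint_notMem_projPoints hn hT w)
  · obtain ⟨w, ⟨hw, rfl⟩, hdist⟩ := Set.mem_iUnion₂.1 hmem
    have hpow : (0 : ℝ) < 8⁻¹ ^ w.length := by positivity
    exact ⟨w, hw, rfl, (Metric.mem_closedBall.1 hdist).trans_lt (by linarith)⟩

theorem exists_mem_paths_nearWord (hn : 2 ≤ n) (hT : T.1.Infinite)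
    (hy : y ∈ projPoints (ratPoint n 0) (treeSet n T)) :
    ∃ z ∈ paths T, ∀ m, NearWord n y ((List.range m).map z) := by
  choose w hwT hlen hnear using exists_nearWord hn hT hy
  have hprefix : ∀ m, w m <+: w (m + 1) := fun m => by
    have htake := List.take_prefix m (w (m + 1))
    have hlen' : ((w (m + 1)).take m).length = (w m).length := by
      rw [List.length_take_of_le (by rw [hlen]; omega), hlen]
    rwa [((hnear (m + 1)).of_prefix hn htake).unique hn (hnear m) hlen'] at htake
  obtain ⟨z, hz⟩ := exists_map_range_eq hlen hprefix
  exact ⟨z, fun m => hz m ▸ hwT m, fun m => hz m ▸ hnear m⟩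

end Paths

/-! ### Names of the closed set coded by a tree -/

theorem OracleComputable.join {f g : Baire → ℕ → ℕ} (hf : OracleComputable f)
    (hg : OracleComputable g) : OracleComputable fun p => join (f p) (g p) := by
  have hhalf : OracleComputable fun _ m => m / 2 := .primrec₂_comp .nat_div .id (.const 2)
  have heven : OracleDecidable fun _ m => m % 2 = 0 :=
    .eq (.primrec₂_comp .nat_mod .id (.const 2)) (.const 0)
  exact heven.ite (hf.comp hhalf) (hg.comp hhalf)

/-- A bound for the codes of the words of length at most `m`. -/
def wordCodeBound : ℕ → ℕ
  | 0 => 0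
  | m + 1 => (Nat.pair 1 (wordCodeBound m)).succ

theorem encode_le_wordCodeBound {m : ℕ} {w : List Bool} (h : w.length ≤ m) :
    Encodable.encode w ≤ wordCodeBound m := by
  induction w generalizing m with
  | nil => exact Nat.zero_le _
  | cons b w ih =>
    obtain ⟨m, rfl⟩ := Nat.exists_eq_add_of_lt h
    have hb : Encodable.encode b ≤ 1 := by cases b <;> decide
    exact Nat.succ_le_succ (pair_le_pair hb (ih (by omega)))

theorem primrec_wordCodeBound : Primrec wordCodeBound := by
  have hstep : Primrec₂ fun (_ : ℕ) b => (Nat.pair 1 b).succ :=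
    Primrec.succ.comp (Primrec₂.natPair.comp (.const 1) .snd)
  refine (Primrec.nat_rec₁ 0 hstep).of_eq fun m => ?_
  induction m with
  | zero => rfl
  | succ m ih => simp only [wordCodeBound, ← ih]

theorem OracleDecidable.forall_length_le {α : Type} [Primcodable α]
    {P : Baire → α × List Bool → Prop} {m : Baire → α → ℕ} (hP : OracleDecidable P)
    (hm : OracleComputable m) :
    OracleDecidable fun p a => ∀ w, w.length ≤ m p a → P p (a, w) := by
  have hword : OracleComputable fun _ (z : α × ℕ) => word z.2 :=
    .primrec_comp primrec_word (.snd .id)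
  have hbody : OracleDecidable fun p (z : α × ℕ) =>
      (word z.2).length ≤ m p z.1 → P p (z.1, word z.2) :=
    (OracleDecidable.nat_le (hword.primrec_comp .list_length) (hm.comp (.fst .id))).imp
      (hP.comp (.pair (.fst .id) hword))
  refine (hbody.forall_lt (hm.primrec_comp (Primrec.succ.comp primrec_wordCodeBound))).of_iff
    fun p a => ⟨fun h w hw => ?_, fun h c _ => h (word c)⟩
  simpa only [word_encode] using h _ (Nat.lt_succ_of_le (encode_le_wordCodeBound hw))
    (by simpa only [word_encode] using hw)

/-- The points coded by the words of length at most `m` of the tree with the name `t` stay so far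
from the basic ball with the code `k` that the points coded by their extensions avoid it. -/
def SeenDisjoint (n : ℕ) (t : Baire) (k m : ℕ) : Prop :=
  ∀ w : List Bool, w.length ≤ m → t (Encodable.encode w) = 1 →
    ballRadius k + (8 : ℝ)⁻¹ ^ m ≤ dist (ballCenter n k) (levelPoint n w)

/-- The basic ball with the code `k` contains the point coded by the word with the number `j`, and
this word is in the tree with the name `t`. -/
def SeenMeeting (n : ℕ) (t : Baire) (k j : ℕ) : Prop :=
  t j = 1 ∧ dist (ballCenter n k) (levelPoint n (word j)) < ballRadius k

open Classical in
/-- The entry with the index `⟨k, m⟩` of a negative name of the closed set coded by the tree with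
the name `t`. The default `0` is the code of an empty ball. -/
def negEntry (n : ℕ) (t : Baire) (s : ℕ) : ℕ :=
  if SeenDisjoint n t s.unpair.1 s.unpair.2 then s.unpair.1 else 0

open Classical in
/-- The entry with the index `⟨k, j⟩` of a positive name of the closed set coded by the tree with
the name `t`. The default is the code of the ball of radius two around the origin. -/
def posEntry (n : ℕ) (t : Baire) (s : ℕ) : ℕ :=
  if SeenMeeting n t s.unpair.1 s.unpair.2 then s.unpair.1 else Nat.pair 0 (Nat.pair 2 0)

theorem oracleComputable_negEntry (n : ℕ) : OracleComputable (negEntry n) := by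
  have hk : OracleComputable fun _ (s : ℕ) => s.unpair.1 := .fst (.unpair .id)
  have hm : OracleComputable fun _ (s : ℕ) => s.unpair.2 := .snd (.unpair .id)
  have hs : OracleComputable fun _ (z : ℕ × List Bool) => z.1 := .fst .id
  have hw : OracleComputable fun _ (z : ℕ × List Bool) => z.2 := .snd .id
  have hmem : OracleDecidable fun t (z : ℕ × List Bool) => t (Encodable.encode z.2) = 1 :=
    .eq (.apply (hw.primrec_comp .encode)) (.const 1)
  have hfar := (OraclePoint.ballCenter n (hk.comp hs)).le_dist (.levelPoint n hw)
    ((OracleRational.ballRadius (hk.comp hs)).add (.inv_pow 8 (hm.comp hs)))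
  have hseen : OracleDecidable fun t (s : ℕ) => SeenDisjoint n t s.unpair.1 s.unpair.2 :=
    (hmem.imp hfar).forall_length_le hm
  classical exact hseen.ite hk (.const 0)

theorem oracleComputable_posEntry (n : ℕ) : OracleComputable (posEntry n) := by
  have hk : OracleComputable fun _ (s : ℕ) => s.unpair.1 := .fst (.unpair .id)
  have hj : OracleComputable fun _ (s : ℕ) => s.unpair.2 := .snd (.unpair .id)
  have hseen : OracleDecidable fun t (s : ℕ) => SeenMeeting n t s.unpair.1 s.unpair.2 :=
    (OracleDecidable.eq (.apply hj) (.const 1)).and ((OraclePoint.ballCenter n hk).dist_lt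
      (.levelPoint n (hj.primrec_comp primrec_word)) (.ballRadius hk))
  classical exact hseen.ite hk (.const _)

section Names

variable {n : ℕ} {t : Baire} {T : BinTree}

theorem apply_encode_eq_one_iff (ht : treeRep.IsName t T) {w : List Bool} :
    t (Encodable.encode w) = 1 ↔ w ∈ T.1 := by
  rw [(ht _).2, word_encode]

theorem basicBall_inter_treeSet_nonempty {k : ℕ} :
    (basicBall n k ∩ treeSet n T).Nonempty ↔ ∃ w ∈ T.1, levelPoint n w ∈ basicBall n k := by
  have hopen : IsOpen (basicBall n k) := Metric.isOpen_ball
  rw [treeSet, Set.inter_comm, closure_inter_open_nonempty_iff hopen, Set.inter_comm,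
    Set.inter_nonempty_iff_exists_right, Set.exists_mem_image]

theorem levelPoint_notMem_basicBall_of_seenDisjoint (hn : 2 ≤ n) (ht : treeRep.IsName t T)
    {k m : ℕ} (h : SeenDisjoint n t k m) {w : List Bool} (hw : w ∈ T.1) :
    levelPoint n w ∉ basicBall n k := by
  have hfar : ∀ v ∈ T.1, v.length ≤ m →
      ballRadius k + (8 : ℝ)⁻¹ ^ m ≤ dist (ballCenter n k) (levelPoint n v) :=
    fun v hv hlen => h v hlen ((apply_encode_eq_one_iff ht).2 hv)
  have hpos : (0 : ℝ) < 8⁻¹ ^ m := by positivity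
  rw [mem_basicBall_iff, dist_comm, not_lt]
  rcases le_total w.length m with hlen | hlen
  · linarith [hfar w hw hlen]
  · have htake : (w.take m).length = m := List.length_take_of_le hlen
    have hprefix := List.take_prefix m w
    have hnear := dist_levelPoint_le_of_prefix hn hprefix
    rw [htake] at hnear
    linarith [hfar _ (T.2 w hw _ hprefix) htake.le,
      dist_triangle (ballCenter n k) (levelPoint n w) (levelPoint n (w.take m))]

theorem exists_seenDisjoint (ht : treeRep.IsName t T) {y : Euc n} (hy : y ∉ treeSet n T) :
    ∃ k m, y ∈ basicBall n k ∧ SeenDisjoint n t k m := by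
  obtain ⟨ε, hε, hball⟩ := Metric.isOpen_iff.1 isClosed_closure.isOpen_compl y hy
  obtain ⟨k, hyk, hk⟩ := exists_mem_basicBall_radius_lt y (ε := ε / 4) (by positivity)
  obtain ⟨m, hm⟩ : ∃ m : ℕ, (8 : ℝ)⁻¹ ^ m < ε / 2 :=
    exists_pow_lt_of_lt_one (by positivity) (by norm_num)
  refine ⟨k, m, hyk, fun w _ hw => ?_⟩
  have hfar : ε ≤ dist (levelPoint n w) y := by
    by_contra! h
    exact hball h (levelPoint_mem_treeSet ((apply_encode_eq_one_iff ht).1 hw))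
  rw [mem_basicBall_iff, dist_comm] at hyk
  linarith [dist_triangle_left (levelPoint n w) y (ballCenter n k)]

theorem negName_negEntry (hn : 2 ≤ n) (ht : treeRep.IsName t T) :
    NegName n (negEntry n t) (treeSet n T) := by
  rw [NegName, eq_compl_comm]
  ext y
  simp only [Set.mem_iUnion, exists_prop, Set.mem_range, exists_exists_eq_and, Set.mem_compl_iff]
  constructor
  · rintro ⟨s, hs⟩ hy
    unfold negEntry at hs
    split_ifs at hs with h
    · obtain ⟨w, hw, hwk⟩ := basicBall_inter_treeSet_nonempty.1 ⟨y, hs, hy⟩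
      exact levelPoint_notMem_basicBall_of_seenDisjoint hn ht h hw hwk
    · simp [basicBall, nonnegRatNum] at hs
  · intro hy
    obtain ⟨k, m, hyk, hseen⟩ := exists_seenDisjoint ht hy
    exact ⟨Nat.pair k m, by simpa [negEntry, hseen] using hyk⟩

theorem posName_posEntry (hn : 2 ≤ n) (ht : treeRep.IsName t T) (hT : T.1.Nonempty) :
    PosName n (posEntry n t) (treeSet n T) := by
  intro k
  rw [basicBall_inter_treeSet_nonempty]
  constructor
  · rintro ⟨s, rfl⟩
    unfold posEntry
    split_ifs with h
    · obtain ⟨htree, hdist⟩ := h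
      rw [dist_comm] at hdist
      exact ⟨word s.unpair.2, (ht _).2.1 htree, mem_basicBall_iff.2 hdist⟩
    · obtain ⟨w, hw⟩ := hT
      have hpow : (8 : ℝ)⁻¹ ^ w.length ≤ 1 := pow_le_one₀ (by norm_num) (by norm_num)
      have hdist : dist (levelPoint n w) (ratPoint n 0) < 2 := by
        rw [dist_comm, dist_zero_levelPoint hn]
        linarith
      exact ⟨w, hw, by simpa [basicBall, nonnegRatNum] using hdist⟩
  · rintro ⟨w, hw, hwk⟩
    rw [mem_basicBall_iff, dist_comm] at hwk
    have hseen : SeenMeeting n t k (Encodable.encode w) :=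
      ⟨(apply_encode_eq_one_iff ht).2 hw, by rwa [word_encode]⟩
    exact ⟨Nat.pair k (Encodable.encode w), by simp [posEntry, hseen]⟩

theorem isName_ratPoint (n k : ℕ) : (cauchyRep n).IsName (fun _ => k) (ratPoint n k) :=
  isName_of_dist_le_half fun i => by
    rw [dist_self]
    positivity

end Names

/-! ### Reading off a path from a projection point -/

/-- The number `s = ⟨c, j⟩` shows that the bit `m` of the path is `v`: the entry `j` of the name `q`
is close enough to the point of the circle coded by the word with the number `c`. -/
def SeenBit (n : ℕ) (q : Baire) (m v s : ℕ) : Prop :=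
  (word s.unpair.1).length = m + 1 ∧ ((word s.unpair.1).getD m false).toNat = v ∧
    dist (ratPoint n (q s.unpair.2)) (circlePoint n (word s.unpair.1)) <
      (8 : ℝ)⁻¹ ^ (m + 1) / 2 - (2 : ℝ)⁻¹ ^ s.unpair.2

theorem oracleDecidable_seenBit (n : ℕ) :
    OracleDecidable fun q (a : ℕ × ℕ × ℕ) => SeenBit n q a.1 a.2.1 a.2.2 := by
  have hm : OracleComputable fun _ (a : ℕ × ℕ × ℕ) => a.1 := .fst .id
  have hv : OracleComputable fun _ (a : ℕ × ℕ × ℕ) => a.2.1 := .fst (.snd .id)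
  have hs : OracleComputable fun _ (a : ℕ × ℕ × ℕ) => a.2.2.unpair := .unpair (.snd (.snd .id))
  have hw : OracleComputable fun _ (a : ℕ × ℕ × ℕ) => word a.2.2.unpair.1 :=
    hs.fst.primrec_comp primrec_word
  have hlen := OracleDecidable.eq (hw.primrec_comp .list_length) (hm.primrec_comp .succ)
  have hgetD := OracleComputable.primrec₂_comp (Primrec.list_getD false) hw hm
  have hbit := OracleDecidable.eq (hgetD.primrec_comp (.dom_bool Bool.toNat)) hv
  exact hlen.and (hbit.and ((OraclePoint.ratPoint (.apply hs.snd)).dist_lt (.circlePoint n hw)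
    (((OracleRational.inv_pow 8 (hm.primrec_comp .succ)).div (.const 2)
      fun _ _ => by norm_num).sub (.inv_pow 2 hs.snd))))

section SeenBit

variable {n : ℕ} {q : Baire} {y : Euc n} {z : ℕ → Bool}

theorem exists_seenBit_iff (hn : 2 ≤ n) (hq : (cauchyRep n).IsName q y)
    (hz : ∀ m, NearWord n y ((List.range m).map z)) {m v : ℕ} :
    (∃ s, SeenBit n q m v s) ↔ v = (z m).toNat := by
  have hget : ((List.range (m + 1)).map z).getD m false = z m := by
    simp
  constructor
  · rintro ⟨s, hlen, rfl, hdist⟩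
    have hnear : NearWord n y (word s.unpair.1) := by
      rw [NearWord, hlen]
      exact (dist_lt_iff_of_isName hq).2 ⟨_, hdist⟩
    rw [hnear.unique hn (hz (m + 1)) (by simpa using hlen), hget]
  · rintro rfl
    have hnear := hz (m + 1)
    rw [NearWord, List.length_map, List.length_range] at hnear
    obtain ⟨j, hj⟩ := (dist_lt_iff_of_isName hq).1 hnear
    refine ⟨Nat.pair (Encodable.encode ((List.range (m + 1)).map z)) j, ?_⟩
    simp only [SeenBit, Nat.unpair_pair, word_encode, hget]
    exact ⟨by simp, trivial, hj⟩

end SeenBit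

theorem strongWeihrauchLE_WKL_proj {n : ℕ} (hn : 2 ≤ n) : StrongWeihrauchLE WKL (Proj n) := by
  refine strongWeihrauchLE_of_search
    (pre := fun t => join (fun _ => 0) (join (negEntry n t) (posEntry n t)))
    (.join (.const 0) (.join (oracleComputable_negEntry n) (oracleComputable_posEntry n)))
    (oracleDecidable_seenBit n) fun t T ht hT => ?_
  obtain ⟨w, hw⟩ := Set.Infinite.nonempty hT
  refine ⟨(ratPoint n 0, ⟨treeSet n T, isClosed_closure, _, levelPoint_mem_treeSet hw⟩),
    Set.mem_univ _, ⟨_, _, rfl, isName_ratPoint n 0, _, _, rfl, negName_negEntry hn ht,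
      posName_posEntry hn ht ⟨w, hw⟩⟩, fun q y hy hq => ?_⟩
  obtain ⟨z, hz, hnear⟩ := exists_mem_paths_nearWord hn hT hy
  have hbit := fun m v => exists_seenBit_iff hn hq hnear (m := m) (v := v)
  exact ⟨fun m => ⟨_, (hbit m _).2 rfl⟩, fun r hr => ⟨z, hz, fun m => (hbit m _).1 (hr m)⟩⟩

end Wei

end

theorem mainTheorem1 (n : ℕ) (hn : 2 ≤ n) :
    Wei.StrongWeihrauchEquiv (Wei.Proj n) Wei.WKL :=
  ⟨Wei.strongWeihrauchLE_proj_WKL n, Wei.strongWeihrauchLE_WKL_proj hn⟩
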